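/- Let $\mathbb D=\{z\in\mathbb C:|z|\le 1\}$. For $n\ge 1$, a unit vector $a\in\mathbb C^n$ (for the Euclidean norm) and $t\in\mathbb R$, let $$A_n(a,t)=\mathrm{vol}_{2(n-1)}\{z\in\mathbb D^n : \langle a,z\rangle=t\},$$ where $\mathrm{vol}_{2(n-1)}$ is the real $2(n-1)$-dimensional Lebesgue measure on the affine hyperplane ($\mathbb C^n$ being identified with $\mathbb R^{2n}$). For $1\le k\le n$ let $a^{(k)}=\frac1{\sqrt k}(1,\dots,1,0,\dots,0)\in\mathbb C^n$, with $k$ ones. Then: 1. For every real $t$, $\displaystyle\lim_{n\to\infty}\pi^{-(n-1)}A_n(a^{(n)},t)=2\exp(-2t^2)$. 2. There is a number $t_0$ with $0.62985<t_0<0.6299$ (so $t_0\simeq 0.6299$) such that $2\exp(-2t_0^2)=\frac1\pi A_2(a^{(2)},t_0)$, while $2\exp(-2t^2)>\frac1\pi A_2(a^{(2)},t)$ for all $0<t<t_0$. 3. For all $0<t<t_0$ and all integers $n\ge5$ with $n>\frac1t$ one has $A_n(a^{(n)},t)>A_n(a^{(2)},t)$; in particular, $a^{(2)}$ does not maximize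 $A_n(\cdot,t)$ over the unit vectors of $\mathbb C^n$. -/

import Mathlib

open Filter Topology
open scoped MeasureTheory

noncomputable section

/-- The `n`-dimensional polydisc `𝔻ⁿ`, as a subset of `ℂⁿ` with its Euclidean norm. -/
def polydisc (n : ℕ) : Set (EuclideanSpace ℂ (Fin n)) :=
  {z | ∀ i, ‖z i‖ ≤ 1}

/-- The section of the polydisc by the complex affine hyperplane `⟨a, z⟩ = t`. -/
def polydiscSection {n : ℕ} (a : EuclideanSpace ℂ (Fin n)) (t : ℂ) :
    Set (EuclideanSpace ℂ (Fin n)) :=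
  {z | z ∈ polydisc n ∧ inner ℂ a z = t}

/-- The complex parallel section function `A_{∞,ℂ}(a, t)`: the real `2(n-1)`-dimensional
Lebesgue volume of the section. The measure `μHE[d]` is the Hausdorff measure of dimension `d`,
normalized so that it is Lebesgue measure on `d`-dimensional Euclidean spaces. -/
def sectionVol {n : ℕ} (a : EuclideanSpace ℂ (Fin n)) (t : ℂ) : ℝ :=
  (μHE[2 * (n - 1)] (polydiscSection a t)).toReal

/-- The vector `a^{(k)} = k^{-1/2} (1, …, 1, 0, …, 0)` of `ℂⁿ` with `k` ones (for `1 ≤ k ≤ n`). -/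
def diagVec (n k : ℕ) : EuclideanSpace ℂ (Fin n) :=
  WithLp.toLp 2 fun i => if (i : ℕ) < k then (((1 / Real.sqrt k : ℝ)) : ℂ) else 0

end

/-! ### Bessel–Clifford functions -/

/-! Write `B_k` for `besselClifford k`. The Fourier transform of the indicator of the unit disc is
`π B_1(π²|ξ|²)`. A section of the polydisc orthogonal to the main diagonal is a graph over the
remaining coordinates, so its volume is a convolution of disc indicators evaluated at a point.
Fourier inversion in polar coordinates then gives `A_n(a^(n), t) = π^(n-1) · n ∫₀^∞ B_1(y)^n B_0(n
t² y) dy` (`sectionVol_diagVec_self_eq`).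

Near `0`, `log B_1(y) = -(y/2 + y²/24 + y³/144 + ...)`, so for large `n` the power `B_1^n` is
`exp(-n y/2)` times a small correction. The Laplace transform of `y^k B_0(c y)` is explicit: a
Laguerre polynomial times an exponential. The leading term of the integral is therefore `2
exp(-2t²)`, which is the limit in the first claim. The error is controlled effectively: with `x =
2t²`, `diagonalIntegral_ge` bounds the integral below by `2 exp(-x)(1 - (x²-4x+2)/(6n) - ...)` up to
an explicit multiple of `1/n²`, for all `n ≥ 5`.

The section orthogonal to `a^(2)` is a lens times a polydisc, with normalized volume `2 - (8/π)
∫₀^{t/√2} √(1-s²) ds` (`sectionVol_diagVec_two_eq`). Its distance below the Gaussian limit is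
`gaussianGap`. This is positive on `(0, 1/2]`, strictly decreasing on `[1/2, 0.63]`, and changes
sign between `0.62985` and `0.6299`, which gives `t₀`.

For the third claim the correction at `s = 1/n` must stay below the gap (`lt_diagonalIntegral`). For
small `t` the gap is about `1.8 t` and the correction about `2s/3`, whence the condition `n > 1/t`.
Near `t₀` the gap vanishes, but there `x²-4x+2 < 0`, so the first-order correction has the
favourable sign and outweighs the `1/n²` terms as soon as `n ≥ 5`. -/

open Nat in
/-- The Bessel–Clifford function `∑ (-y)^m / (m! (m+k)!)`, that is `y^(-k/2) J_k(2√y)`. -/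
noncomputable def besselClifford (k : ℕ) (y : ℝ) : ℝ :=
  ∑' m : ℕ, (-y) ^ m / ((m ! : ℝ) * ((m + k) ! : ℝ))

open Nat in
/-- Partial sums of the series of `besselClifford k`. -/
noncomputable def besselCliffordSum (k N : ℕ) (y : ℝ) : ℝ :=
  ∑ m ∈ Finset.range N, (-y) ^ m / ((m ! : ℝ) * ((m + k) ! : ℝ))

section BesselClifford

open Nat

theorem besselClifford_norm_le (k m : ℕ) {y R : ℝ} (hy : |y| ≤ R) :
    ‖(-y) ^ m / ((m ! : ℝ) * ((m + k) ! : ℝ))‖ ≤ R ^ m / (m ! : ℝ) := by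
  have h1 : (1 : ℝ) ≤ ((m + k) ! : ℝ) := by exact_mod_cast Nat.succ_le_of_lt (Nat.factorial_pos _)
  have h2 : (0 : ℝ) < (m ! : ℝ) := by exact_mod_cast Nat.factorial_pos _
  have hR : 0 ≤ R := (abs_nonneg y).trans hy
  rw [norm_div, norm_pow, norm_neg, Real.norm_eq_abs, Real.norm_of_nonneg (by positivity)]
  gcongr
  nlinarith

theorem summable_besselClifford (k : ℕ) (y : ℝ) :
    Summable fun m : ℕ => (-y) ^ m / ((m ! : ℝ) * ((m + k) ! : ℝ)) :=
  Summable.of_norm_bounded (Real.summable_pow_div_factorial |y|)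
    fun m => besselClifford_norm_le k m le_rfl

theorem hasSum_besselClifford (k : ℕ) (y : ℝ) :
    HasSum (fun m : ℕ => (-y) ^ m / ((m ! : ℝ) * ((m + k) ! : ℝ))) (besselClifford k y) :=
  (summable_besselClifford k y).hasSum

@[simp]
theorem besselClifford_zero (k : ℕ) : besselClifford k 0 = 1 / (k ! : ℝ) := by
  rw [besselClifford, tsum_eq_single 0]
  · simp
  · intro m hm; simp [hm]

theorem hasDerivAt_besselClifford (k : ℕ) (y : ℝ) :
    HasDerivAt (besselClifford k) (-besselClifford (k + 1) y) y := by
  obtain ⟨R, hR⟩ : ∃ R, R = |y| + 1 := ⟨_, rfl⟩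
  have hR0 : 0 < R := by rw [hR]; positivity
  have key : HasDerivAt (fun z => ∑' m : ℕ, (-z) ^ m / ((m ! : ℝ) * ((m + k) ! : ℝ)))
      (∑' m : ℕ, -((m : ℝ) * (-y) ^ (m - 1) / ((m ! : ℝ) * ((m + k) ! : ℝ)))) y := by
    have hs : Summable fun m : ℕ => (m : ℝ) * R ^ (m - 1) / (m ! : ℝ) := by
      rw [← summable_nat_add_iff 1]
      refine (Real.summable_pow_div_factorial R).congr fun m => ?_
      rw [Nat.factorial_succ]; push_cast
      have : (m ! : ℝ) ≠ 0 := by exact_mod_cast Nat.factorial_ne_zero _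
      field_simp
    refine hasDerivAt_tsum_of_isPreconnected
      (g := fun (m : ℕ) (z : ℝ) => (-z) ^ m / ((m ! : ℝ) * ((m + k) ! : ℝ)))
      (g' := fun (m : ℕ) (z : ℝ) => -((m : ℝ) * (-z) ^ (m - 1) / ((m ! : ℝ) * ((m + k) ! : ℝ))))
      (t := Metric.ball 0 R) (y₀ := 0) hs
      Metric.isOpen_ball (convex_ball _ _).isPreconnected (fun m z _ => ?_) (fun m z hz => ?_)
      (Metric.mem_ball_self hR0) (summable_besselClifford k 0) (by simp [hR])
    · have h := ((hasDerivAt_neg z).pow m).div_const ((m ! : ℝ) * ((m + k) ! : ℝ))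
      refine h.congr_deriv ?_
      ring
    · have hz' : |z| ≤ R := by simpa using (Metric.mem_ball.1 hz).le
      have h1 : (1 : ℝ) ≤ ((m + k) ! : ℝ) := by
        exact_mod_cast Nat.succ_le_of_lt (Nat.factorial_pos _)
      have h2 : (0 : ℝ) < (m ! : ℝ) := by exact_mod_cast Nat.factorial_pos _
      rw [norm_neg, norm_div, norm_mul, norm_pow, norm_neg, Real.norm_eq_abs z,
        Real.norm_of_nonneg (by positivity : (0 : ℝ) ≤ (m ! : ℝ) * ((m + k) ! : ℝ)),
        Real.norm_of_nonneg (by positivity : (0 : ℝ) ≤ (m : ℝ))]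
      gcongr
      nlinarith
  refine key.congr_deriv ?_
  rw [besselClifford, ← tsum_neg]
  have hs : Summable fun m : ℕ => -((m : ℝ) * (-y) ^ (m - 1) / ((m ! : ℝ) * ((m + k) ! : ℝ))) := by
    rw [← summable_nat_add_iff 1]
    refine (summable_besselClifford (k + 1) y).neg.congr fun m => ?_
    rw [Nat.factorial_succ m, show m + 1 + k = m + (k + 1) by ring]; push_cast
    have : (m ! : ℝ) ≠ 0 := by exact_mod_cast Nat.factorial_ne_zero _
    field_simp
  rw [hs.tsum_eq_zero_add]
  simp only [CharP.cast_eq_zero, zero_mul, zero_div, neg_zero, zero_add]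
  refine tsum_congr fun m => ?_
  rw [Nat.factorial_succ m, show m + 1 + k = m + (k + 1) by ring]; push_cast
  have : (m ! : ℝ) ≠ 0 := by exact_mod_cast Nat.factorial_ne_zero _
  field_simp

theorem continuous_besselClifford (k : ℕ) : Continuous (besselClifford k) :=
  continuous_iff_continuousAt.2 fun y => (hasDerivAt_besselClifford k y).continuousAt

/-- The contiguity relation, equivalent to Bessel's differential equation. -/
theorem besselClifford_contiguous (k : ℕ) (y : ℝ) :
    besselClifford k y = (k + 1) * besselClifford (k + 1) y - y * besselClifford (k + 2) y := by
  have h1 := (hasSum_besselClifford (k + 1) y).mul_left ((k : ℝ) + 1)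
  have h2 := (hasSum_besselClifford (k + 2) y).mul_left (-y)
  have h3 : HasSum (fun m : ℕ => (m : ℝ) * ((-y) ^ m / ((m ! : ℝ) * ((m + (k + 1)) ! : ℝ))))
      (-y * besselClifford (k + 2) y) := by
    rw [← hasSum_nat_add_iff' 1]
    simp only [Finset.range_one, Finset.sum_singleton, CharP.cast_eq_zero, zero_mul, sub_zero]
    refine h2.congr_fun fun m => ?_
    rw [Nat.factorial_succ m, show m + 1 + (k + 1) = m + (k + 2) by ring]; push_cast
    have : (m ! : ℝ) ≠ 0 := by exact_mod_cast Nat.factorial_ne_zero _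
    field_simp
    ring
  have h4 := h1.add h3
  have h5 : HasSum (fun m : ℕ => (-y) ^ m / ((m ! : ℝ) * ((m + k) ! : ℝ)))
      ((k + 1) * besselClifford (k + 1) y + -y * besselClifford (k + 2) y) := by
    refine h4.congr_fun fun m => ?_
    rw [show m + (k + 1) = (m + k) + 1 by ring, Nat.factorial_succ (m + k)]; push_cast
    have : (m ! : ℝ) ≠ 0 := by exact_mod_cast Nat.factorial_ne_zero _
    have : ((m + k) ! : ℝ) ≠ 0 := by exact_mod_cast Nat.factorial_ne_zero _
    field_simp
    ring
  rw [(hasSum_besselClifford k y).unique h5]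
  ring

/-- By the contiguity relation the derivative of this energy is `-(2k+1) B_{k+1}²`. Evaluating the
energy at one point bounds both `B_k` and `√y B_{k+1}` from there on. -/
theorem antitoneOn_energy_besselClifford (k : ℕ) :
    AntitoneOn (fun y => besselClifford k y ^ 2 + y * besselClifford (k + 1) y ^ 2)
      (Set.Ici 0) := by
  have hd : ∀ y, HasDerivAt (fun y => besselClifford k y ^ 2 + y * besselClifford (k + 1) y ^ 2)
      (-(2 * k + 1) * besselClifford (k + 1) y ^ 2) y := by
    intro y
    have h := ((hasDerivAt_besselClifford k y).pow 2).add
      ((hasDerivAt_id y).mul ((hasDerivAt_besselClifford (k + 1) y).pow 2))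
    refine h.congr_deriv ?_
    have := besselClifford_contiguous k y
    simp only [id, Nat.cast_ofNat, this, show k + 1 + 1 = k + 2 from rfl]
    simp
    ring
  refine antitoneOn_of_deriv_nonpos (convex_Ici 0)
    (fun y _ => (hd y).continuousAt.continuousWithinAt)
    (fun y _ => (hd y).differentiableAt.differentiableWithinAt) fun y _ => ?_
  rw [(hd y).deriv]
  have : 0 ≤ (2 * (k : ℝ) + 1) * besselClifford (k + 1) y ^ 2 := by positivity
  linarith

theorem abs_besselClifford_le (k : ℕ) {y : ℝ} (hy : 0 ≤ y) :
    |besselClifford k y| ≤ 1 / (k ! : ℝ) := by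
  have h := antitoneOn_energy_besselClifford k (Set.mem_Ici.2 le_rfl) (Set.mem_Ici.2 hy) hy
  simp only [besselClifford_zero, zero_mul, add_zero] at h
  have h2 : 0 ≤ y * besselClifford (k + 1) y ^ 2 := by positivity
  exact abs_le_of_sq_le_sq (by linarith) (by positivity)

theorem hasDerivAt_besselCliffordSum (k N : ℕ) (y : ℝ) :
    HasDerivAt (besselCliffordSum k (N + 1)) (-besselCliffordSum (k + 1) N y) y := by
  induction N with
  | zero =>
    have e : besselCliffordSum k (0 + 1) = fun _ => 1 / (k ! : ℝ) := by
      funext z; simp [besselCliffordSum]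
    rw [e]
    simpa [besselCliffordSum] using hasDerivAt_const y (1 / (k ! : ℝ))
  | succ N ih =>
    have h := ((hasDerivAt_neg y).pow (N + 1)).div_const (((N + 1) ! : ℝ) * ((N + 1 + k) ! : ℝ))
    have e : besselCliffordSum k (N + 1 + 1) = fun z => besselCliffordSum k (N + 1) z +
        (-z) ^ (N + 1) / (((N + 1) ! : ℝ) * ((N + 1 + k) ! : ℝ)) := by
      funext z; rw [besselCliffordSum, Finset.sum_range_succ]; rfl
    rw [e]
    refine (ih.add h).congr_deriv ?_
    have e2 : besselCliffordSum (k + 1) (N + 1) y = besselCliffordSum (k + 1) N y +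
        (-y) ^ N / ((N ! : ℝ) * ((N + (k + 1)) ! : ℝ)) := by
      rw [besselCliffordSum, Finset.sum_range_succ]; rfl
    rw [e2, Nat.factorial_succ N, show N + 1 + k = N + (k + 1) by ring]; push_cast
    have : (N ! : ℝ) ≠ 0 := by exact_mod_cast Nat.factorial_ne_zero _
    field_simp
    ring

/-- The partial sums are alternately above and below the sum, for every `y ≥ 0`. -/
theorem besselClifford_alternating (N : ℕ) : ∀ (k : ℕ) {y : ℝ}, 0 ≤ y →
    0 ≤ (-1) ^ N * (besselCliffordSum k (N + 1) y - besselClifford k y) := by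
  induction N with
  | zero =>
    intro k y hy
    have := (abs_le.1 (abs_besselClifford_le k hy)).2
    simpa [besselCliffordSum] using this
  | succ N ih =>
    intro k y hy
    -- Differentiation turns the error of order `N + 1` for `k` into minus the error of order `N`
    -- for `k + 1`. Both functions agree at `0`, so the sign propagates by monotonicity, with no
    -- need for the terms of the series to decrease.
    have hd : ∀ z, HasDerivAt (fun z => (-1) ^ (N + 1) *
        (besselCliffordSum k (N + 1 + 1) z - besselClifford k z))
        ((-1) ^ N * (besselCliffordSum (k + 1) (N + 1) z - besselClifford (k + 1) z)) z := by
      intro z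
      refine (((hasDerivAt_besselCliffordSum k (N + 1) z).sub
        (hasDerivAt_besselClifford k z)).const_mul ((-1) ^ (N + 1))).congr_deriv ?_
      ring
    have hm : MonotoneOn (fun z => (-1) ^ (N + 1) *
        (besselCliffordSum k (N + 1 + 1) z - besselClifford k z)) (Set.Ici 0) := by
      refine monotoneOn_of_deriv_nonneg (convex_Ici 0)
        (fun y _ => (hd y).continuousAt.continuousWithinAt)
        (fun y _ => (hd y).differentiableAt.differentiableWithinAt) fun z hz => ?_
      rw [(hd z).deriv]
      rw [interior_Ici] at hz
      exact ih (k + 1) (le_of_lt hz)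
    have h0 := hm (Set.mem_Ici.2 le_rfl) (Set.mem_Ici.2 hy) hy
    refine le_trans (le_of_eq ?_) h0
    simp [besselCliffordSum, Finset.sum_range_succ']

theorem besselClifford_le_sum (k N : ℕ) (hN : Even N) {y : ℝ} (hy : 0 ≤ y) :
    besselClifford k y ≤ besselCliffordSum k (N + 1) y := by
  have := besselClifford_alternating N k hy
  rw [hN.neg_one_pow] at this
  linarith

theorem sum_le_besselClifford (k N : ℕ) (hN : Odd N) {y : ℝ} (hy : 0 ≤ y) :
    besselCliffordSum k (N + 1) y ≤ besselClifford k y := by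
  have := besselClifford_alternating N k hy
  rw [hN.neg_one_pow] at this
  linarith

end BesselClifford

/-! ### Estimates for the Bessel–Clifford functions of order zero and one -/

/-- The half-line is cut at `3`, a little before the first zero of `B_1` (about `3.67`). Up to `3`
the function `B_1` is positive and has a logarithm; past `3` only this energy bound is used. -/
theorem besselClifford_zero_sq_add_le {y : ℝ} (hy : 3 ≤ y) :
    besselClifford 0 y ^ 2 + y * besselClifford 1 y ^ 2 ≤ (81 / 200) ^ 2 := by
  refine (antitoneOn_energy_besselClifford 0 (Set.mem_Ici.2 (by norm_num : (0 : ℝ) ≤ 3))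
    (Set.mem_Ici.2 (by linarith)) hy).trans ?_
  have a1 := besselClifford_le_sum 0 8 (by decide) (y := 3) (by norm_num)
  have a2 := sum_le_besselClifford 0 7 (by decide) (y := 3) (by norm_num)
  have b1 := besselClifford_le_sum 1 6 (by decide) (y := 3) (by norm_num)
  have b2 := sum_le_besselClifford 1 7 (by decide) (y := 3) (by norm_num)
  norm_num [besselCliffordSum, Finset.sum_range_succ, Nat.factorial] at a1 a2 b1 b2
  show besselClifford 0 3 ^ 2 + 3 * besselClifford 1 3 ^ 2 ≤ _
  nlinarith

theorem abs_besselClifford_zero_le_of_three_le {y : ℝ} (hy : 3 ≤ y) :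
    |besselClifford 0 y| ≤ 81 / 200 := by
  have h := besselClifford_zero_sq_add_le hy
  have h2 : 0 ≤ y * besselClifford 1 y ^ 2 := by positivity
  exact abs_le_of_sq_le_sq (by linarith) (by norm_num)

theorem abs_besselClifford_zero_le_one {y : ℝ} (hy : 0 ≤ y) : |besselClifford 0 y| ≤ 1 := by
  simpa using abs_besselClifford_le 0 hy

theorem abs_besselClifford_one_le_one {y : ℝ} (hy : 0 ≤ y) : |besselClifford 1 y| ≤ 1 := by
  simpa using abs_besselClifford_le 1 hy

theorem besselClifford_one_pos {y : ℝ} (hy : 0 ≤ y) (hy3 : y ≤ 3) : 0 < besselClifford 1 y := by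
  have h := sum_le_besselClifford 1 5 (by decide) hy
  norm_num [besselCliffordSum, Finset.sum_range_succ, Nat.factorial] at h
  refine lt_of_lt_of_le ?_ h
  have h1 : 0 ≤ y ^ 4 * (1 / 2880 - y / 86400) :=
    mul_nonneg (by positivity) (by linarith)
  nlinarith [mul_nonneg (sub_nonneg.2 hy3) (sq_nonneg (y - 4)), mul_nonneg hy (sq_nonneg (y - 3))]

/-- On `[0, 3]` the function decreases, its derivative being `-B_1 < 0`; past `3` the energy bound
applies. -/
theorem neg_le_besselClifford_zero {y : ℝ} (hy : 0 ≤ y) : -(81 / 200) ≤ besselClifford 0 y := by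
  rcases le_total 3 y with h | h
  · exact (abs_le.1 (abs_besselClifford_zero_le_of_three_le h)).1
  · refine (abs_le.1 (abs_besselClifford_zero_le_of_three_le le_rfl)).1.trans ?_
    have hm : AntitoneOn (besselClifford 0) (Set.Icc 0 3) := by
      refine antitoneOn_of_deriv_nonpos (convex_Icc 0 3)
        (continuous_besselClifford 0).continuousOn
        (fun y _ => (hasDerivAt_besselClifford 0 y).differentiableAt.differentiableWithinAt)
        fun z hz => ?_
      rw [(hasDerivAt_besselClifford 0 z).deriv]
      rw [interior_Icc] at hz
      linarith [besselClifford_one_pos hz.1.le hz.2.le]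
    exact hm ⟨hy, h⟩ ⟨by norm_num, le_rfl⟩ h

theorem hasDerivAt_besselClifford_mul_exp {g g' : ℝ → ℝ} (hg : ∀ y, HasDerivAt g (g' y) y) (y : ℝ) :
    HasDerivAt (fun y => besselClifford 1 y * Real.exp (g y))
      ((g' y * besselClifford 1 y - besselClifford 2 y) * Real.exp (g y)) y := by
  refine ((hasDerivAt_besselClifford 1 y).mul (hg y).exp).congr_deriv ?_
  ring

/-- The exponent is the Taylor polynomial of `log B_1` of degree three. With `g` its negative, `B_1
exp g` decreases because `g' B_1 ≤ B_2`, which is checked on alternating partial sums. -/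
theorem besselClifford_one_le_exp {y : ℝ} (hy : 0 ≤ y) (hy3 : y ≤ 3) :
    besselClifford 1 y ≤ Real.exp (-(y / 2 + y ^ 2 / 24 + y ^ 3 / 144)) := by
  have hg : ∀ y : ℝ, HasDerivAt (fun y : ℝ => y / 2 + y ^ 2 / 24 + y ^ 3 / 144)
      (1 / 2 + y / 12 + y ^ 2 / 48) y := fun y => by
    refine ((((hasDerivAt_id y).div_const 2).add ((hasDerivAt_pow 2 y).div_const 24)).add
      ((hasDerivAt_pow 3 y).div_const 144)).congr_deriv ?_
    norm_num; ring
  have hm : AntitoneOn (fun y => besselClifford 1 y *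
      Real.exp (y / 2 + y ^ 2 / 24 + y ^ 3 / 144)) (Set.Icc 0 3) := by
    refine antitoneOn_of_deriv_nonpos (convex_Icc 0 3)
      (fun y _ => (hasDerivAt_besselClifford_mul_exp hg y).continuousAt.continuousWithinAt)
      (fun y _ => (hasDerivAt_besselClifford_mul_exp hg y).differentiableAt.differentiableWithinAt)
      fun z hz => ?_
    rw [(hasDerivAt_besselClifford_mul_exp hg z).deriv]
    rw [interior_Icc] at hz
    obtain ⟨h0, h3⟩ := hz
    refine mul_nonpos_of_nonpos_of_nonneg ?_ (Real.exp_pos _).le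
    have a := besselClifford_le_sum 1 6 (by decide) h0.le
    have b := sum_le_besselClifford 2 5 (by decide) h0.le
    have a' := mul_le_mul_of_nonneg_left a (by positivity : 0 ≤ 1 / 2 + z / 12 + z ^ 2 / 48)
    norm_num [besselCliffordSum, Finset.sum_range_succ, Nat.factorial] at a' b
    have p1 : 0 ≤ z ^ 3 * (1 / 180 - 11 / 8640 * z) := mul_nonneg (by positivity) (by linarith)
    have p2 : 0 ≤ z ^ 5 * (29 / 241920 - 31 / 4838400 * z) :=
      mul_nonneg (by positivity) (by linarith)
    have p3 : 0 ≤ z ^ 7 * (19 / 87091200 - 1 / 174182400 * z) :=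
      mul_nonneg (by positivity) (by linarith)
    norm_num at *
    linarith
  have h := hm ⟨le_rfl, by norm_num⟩ ⟨hy, hy3⟩ hy
  simp only [besselClifford_zero] at h
  norm_num at h
  rw [Real.exp_neg, ← one_div, le_div_iff₀ (Real.exp_pos _)]
  exact h

/-- The true quartic coefficient of `-log B_1` is `1/720 = 5/3600`; raising it to `11/3600` absorbs
all higher terms on this interval. -/
theorem exp_le_besselClifford_one {y : ℝ} (hy : 0 ≤ y) (hy2 : y ≤ 193 / 100) :
    Real.exp (-(y / 2 + y ^ 2 / 24 + y ^ 3 / 144 + 11 / 3600 * y ^ 4)) ≤ besselClifford 1 y := by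
  have hg : ∀ y : ℝ, HasDerivAt (fun y : ℝ => y / 2 + y ^ 2 / 24 + y ^ 3 / 144 + 11 / 3600 * y ^ 4)
      (1 / 2 + y / 12 + y ^ 2 / 48 + 11 / 900 * y ^ 3) y := fun y => by
    refine (((((hasDerivAt_id y).div_const 2).add ((hasDerivAt_pow 2 y).div_const 24)).add
      ((hasDerivAt_pow 3 y).div_const 144)).add
      ((hasDerivAt_pow 4 y).const_mul (11 / 3600))).congr_deriv ?_
    norm_num; ring
  have hm : MonotoneOn (fun y => besselClifford 1 y *
      Real.exp (y / 2 + y ^ 2 / 24 + y ^ 3 / 144 + 11 / 3600 * y ^ 4))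
      (Set.Icc 0 (193 / 100)) := by
    refine monotoneOn_of_deriv_nonneg (convex_Icc _ _)
      (fun y _ => (hasDerivAt_besselClifford_mul_exp hg y).continuousAt.continuousWithinAt)
      (fun y _ => (hasDerivAt_besselClifford_mul_exp hg y).differentiableAt.differentiableWithinAt)
      fun z hz => ?_
    rw [(hasDerivAt_besselClifford_mul_exp hg z).deriv]
    rw [interior_Icc] at hz
    obtain ⟨h0, h3⟩ := hz
    refine mul_nonneg ?_ (Real.exp_pos _).le
    have a := sum_le_besselClifford 1 5 (by decide) h0.le
    have b := besselClifford_le_sum 2 6 (by decide) h0.le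
    have a' := mul_le_mul_of_nonneg_left a
      (by positivity : 0 ≤ 1 / 2 + z / 12 + z ^ 2 / 48 + 11 / 900 * z ^ 3)
    norm_num [besselCliffordSum, Finset.sum_range_succ, Nat.factorial] at a' b
    have p1 : 0 ≤ z ^ 3 * (1 / 150 - 209 / 43200 * z + 1087 / 1209600 * z ^ 2
        - 761 / 9676800 * z ^ 3) := by
      refine mul_nonneg (by positivity) ?_
      nlinarith [mul_nonneg h0.le (sq_nonneg (z - 193 / 100)), mul_nonneg h0.le h0.le,
        mul_nonneg (sub_nonneg.2 h3.le) (sq_nonneg z)]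
    have p3 : 0 ≤ z ^ 7 * (83 / 20736000 - 11 / 77760000 * z) :=
      mul_nonneg (by positivity) (by linarith)
    norm_num at *
    linarith
  have h := hm ⟨le_rfl, by norm_num⟩ ⟨hy, hy2⟩ hy
  simp only [besselClifford_zero] at h
  norm_num at h
  rw [Real.exp_neg, ← one_div, div_le_iff₀ (Real.exp_pos _)]
  exact h

/-- Applied with `q = n y²/24` and `θ = y/6`, so that `θ q = n y³/144`: the quadratic upper bound
keeps the fraction `9/20` of the cubic term. -/
theorem exp_neg_le_quadratic {q θ : ℝ} (hq : 0 ≤ q) (hθ : 0 ≤ θ) (hθ' : θ ≤ 1 / 2) :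
    Real.exp (-((1 + θ) * q)) ≤ 1 - (1 + 9 / 20 * θ) * q + q ^ 2 / 2 := by
  have hd : ∀ q : ℝ, HasDerivAt
      (fun q => (1 - (1 + 9 / 20 * θ) * q + q ^ 2 / 2) * Real.exp ((1 + θ) * q))
      ((11 / 20 * θ + q * (1 - (1 + θ) * (1 + 9 / 20 * θ)) + (1 + θ) * q ^ 2 / 2) *
        Real.exp ((1 + θ) * q)) q := fun q => by
    have h1 : HasDerivAt (fun q => 1 - (1 + 9 / 20 * θ) * q + q ^ 2 / 2)
        (-(1 + 9 / 20 * θ) + q) q := by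
      refine ((((hasDerivAt_id q).const_mul (1 + 9 / 20 * θ)).const_sub 1).add
        ((hasDerivAt_pow 2 q).div_const 2)).congr_deriv ?_
      norm_num
    refine (h1.mul ((hasDerivAt_id q).const_mul (1 + θ)).exp).congr_deriv ?_
    simp only [id, mul_one]
    ring
  have hm : Monotone
      (fun q => (1 - (1 + 9 / 20 * θ) * q + q ^ 2 / 2) * Real.exp ((1 + θ) * q)) := by
    refine monotone_of_deriv_nonneg (fun q => (hd q).differentiableAt) fun q => ?_
    rw [(hd q).deriv]
    refine mul_nonneg ?_ (Real.exp_pos _).le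
    -- Up to a factor `θ`, this is the discriminant condition for the quadratic in `q` in the
    -- derivative; the square `hs` completes it.
    have hB : θ * (29 / 20 + 9 / 20 * θ) ^ 2 ≤ 11 / 10 * (1 + θ) := by nlinarith
    have hs := sq_nonneg ((1 + θ) * q - θ * (29 / 20 + 9 / 20 * θ))
    have : 0 ≤ (1 + θ) * (2 * (11 / 20 * θ + q * (1 - (1 + θ) * (1 + 9 / 20 * θ))
        + (1 + θ) * q ^ 2 / 2)) := by
      nlinarith [mul_le_mul_of_nonneg_left hB hθ]
    have h2 := nonneg_of_mul_nonneg_right this (by positivity)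
    linarith
  have h := hm hq
  simp only [mul_zero, sub_zero, Real.exp_zero] at h
  norm_num at h
  rw [Real.exp_neg, ← one_div, div_le_iff₀ (Real.exp_pos _)]
  exact h

theorem cubic_le_exp_neg {w : ℝ} (hw : 0 ≤ w) :
    1 - w + w ^ 2 / 2 - w ^ 3 / 6 ≤ Real.exp (-w) := by
  have hd : ∀ w : ℝ, HasDerivAt
      (fun w => (1 - w + w ^ 2 / 2 - w ^ 3 / 6) * Real.exp w) (-(w ^ 3 / 6) * Real.exp w) w :=
      fun w => by
    have h1 : HasDerivAt (fun w => 1 - w + w ^ 2 / 2 - w ^ 3 / 6) (-1 + w - w ^ 2 / 2) w := by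
      refine ((((hasDerivAt_id w).const_sub 1).add
        ((hasDerivAt_pow 2 w).div_const 2)).sub ((hasDerivAt_pow 3 w).div_const 6)).congr_deriv ?_
      norm_num; ring
    refine (h1.mul (Real.hasDerivAt_exp w)).congr_deriv ?_
    ring
  have hm : AntitoneOn (fun w => (1 - w + w ^ 2 / 2 - w ^ 3 / 6) * Real.exp w) (Set.Ici 0) := by
    refine antitoneOn_of_deriv_nonpos (convex_Ici 0)
      (fun y _ => (hd y).continuousAt.continuousWithinAt)
      (fun y _ => (hd y).differentiableAt.differentiableWithinAt) fun w hw => ?_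
    rw [(hd w).deriv]
    rw [interior_Ici] at hw
    have hw' : 0 < w := hw
    exact mul_nonpos_of_nonpos_of_nonneg (neg_nonpos.2 (by positivity)) (Real.exp_pos _).le
  have h := hm (Set.mem_Ici.2 le_rfl) (Set.mem_Ici.2 hw) hw
  simp only [Real.exp_zero] at h
  norm_num at h
  rw [Real.exp_neg, ← one_div, le_div_iff₀ (Real.exp_pos _)]
  exact h

theorem besselClifford_one_pow_le {n : ℕ} {y : ℝ} (hy : 0 ≤ y) (hy3 : y ≤ 3) :
    besselClifford 1 y ^ n ≤ Real.exp (-(n * y / 2)) *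
      (1 - n * y ^ 2 / 24 + (n * y ^ 2 / 24) ^ 2 / 2 - 9 / 20 * (n * y ^ 3 / 144)) := by
  refine (pow_le_pow_left₀ (besselClifford_one_pos hy hy3).le
    (besselClifford_one_le_exp hy hy3) n).trans ?_
  rw [← Real.exp_nat_mul]
  have h := exp_neg_le_quadratic (q := n * y ^ 2 / 24) (θ := y / 6) (by positivity)
    (by positivity) (by linarith)
  have e : (n : ℝ) * -(y / 2 + y ^ 2 / 24 + y ^ 3 / 144) =
      -(n * y / 2) + -((1 + y / 6) * (n * y ^ 2 / 24)) := by ring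
  rw [e, Real.exp_add]
  refine mul_le_mul_of_nonneg_left (h.trans (le_of_eq ?_)) (Real.exp_pos _).le
  ring

theorem le_besselClifford_one_pow {n : ℕ} (hn : 5 ≤ n) {y : ℝ} (hy : 0 ≤ y) (hy3 : y ≤ 3) :
    Real.exp (-(n * y / 2)) * (1 - n * y ^ 2 / 24 - n * y ^ 3 / 144) ≤ besselClifford 1 y ^ n := by
  have hn' : (5 : ℝ) ≤ n := by exact_mod_cast hn
  by_cases hs : 1 ≤ n * y ^ 2 / 24 + n * y ^ 3 / 144
  · exact (mul_nonpos_of_nonneg_of_nonpos (Real.exp_pos _).le (by linarith)).trans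
      (pow_nonneg (besselClifford_one_pos hy hy3).le n)
  push Not at hs
  -- Only the case of a positive bracket remains, and with `n ≥ 5` it confines `y` to the range of
  -- `exp_le_besselClifford_one`.
  have hy2 : y ≤ 193 / 100 := by
    by_contra! hc
    have h2 : (193 / 100) ^ 2 ≤ y ^ 2 := by gcongr
    have h3 : (193 / 100) ^ 3 ≤ y ^ 3 := by gcongr
    nlinarith
  refine le_trans ?_ (pow_le_pow_left₀ (Real.exp_pos _).le (exp_le_besselClifford_one hy hy2) n)
  rw [← Real.exp_nat_mul]
  have e : (n : ℝ) * -(y / 2 + y ^ 2 / 24 + y ^ 3 / 144 + 11 / 3600 * y ^ 4) =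
      -(n * y / 2) + -(n * y ^ 2 / 24 + n * y ^ 3 / 144 + 11 / 3600 * n * y ^ 4) := by ring
  rw [e, Real.exp_add]
  refine mul_le_mul_of_nonneg_left (le_trans ?_ (cubic_le_exp_neg (by positivity)))
    (Real.exp_pos _).le
  set s := n * y ^ 2 / 24 + n * y ^ 3 / 144 with hsdef
  set u := 11 / 3600 * n * y ^ 4 with hu
  set w := s + u with hw
  have hs0 : 0 ≤ s := by positivity
  have hu0 : 0 ≤ u := by positivity
  have hws : w ≤ 121 / 100 * s := by
    have h1 : 11 / 3600 * y ^ 2 ≤ 21 / 100 * (1 / 24 + y / 144) := by nlinarith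
    have h2 := mul_le_mul_of_nonneg_left h1 (by positivity : 0 ≤ n * y ^ 2)
    rw [hw, hsdef, hu]
    linarith
  -- The quartic loss `u` has to be paid by `w²/2 - w³/6`, and `u ≤ s² (1/2 - w/6)` suffices. Since
  -- `s = n y² (1 + y/6)/24`, this is the present inequality, with `44/25 = 576 · 11/3600`.
  have hA : 44 / 25 ≤ n * (1 / 2 - w / 6) * (1 + y / 6) ^ 2 := by
    rcases le_total s (7 / 10) with h7 | h7
    · have h1 : 44 / 25 ≤ n * (1 / 2 - w / 6) := by nlinarith
      nlinarith [mul_nonneg (by linarith : (0 : ℝ) ≤ n * (1 / 2 - w / 6))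
        (by positivity : (0 : ℝ) ≤ y / 3 + y ^ 2 / 36)]
    · have hw6 : 59 / 200 ≤ 1 / 2 - w / 6 := by linarith
      rcases le_total 1 y with h1 | h1
      · calc (44 / 25 : ℝ) ≤ 5 * (59 / 200) * (1 + 1 / 6) ^ 2 := by norm_num
          _ ≤ _ := by gcongr
      · have h14 : (14 : ℝ) ≤ n := by
          have h2 : y ^ 2 ≤ 1 := by nlinarith
          have h3 : y ^ 3 ≤ 1 := by nlinarith
          nlinarith
        calc (44 / 25 : ℝ) ≤ 14 * (59 / 200) * (1 + 0 / 6) ^ 2 := by norm_num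
          _ ≤ _ := by gcongr
  have hw1 : 0 ≤ 1 / 2 - w / 6 := by linarith
  have h1 : s ^ 2 * (1 / 2 - w / 6) ≤ w ^ 2 * (1 / 2 - w / 6) := by
    have : s ≤ w := by linarith
    gcongr
  have h2 := mul_le_mul_of_nonneg_left hA (by positivity : 0 ≤ n * y ^ 4 / 576)
  have h3 : n * y ^ 4 / 576 * (n * (1 / 2 - w / 6) * (1 + y / 6) ^ 2) =
      s ^ 2 * (1 / 2 - w / 6) := by rw [hsdef]; ring
  have h4 : n * y ^ 4 / 576 * (44 / 25) = u := by rw [hu]; ring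
  nlinarith

/-! ### Laplace transforms of Bessel–Clifford functions of order zero -/

section Laplace

open MeasureTheory Nat

theorem hasSum_descFactorial_mul_pow_div_factorial (i : ℕ) (z : ℝ) :
    HasSum (fun m : ℕ => (m.descFactorial i : ℝ) * (z ^ m / (m ! : ℝ))) (z ^ i * Real.exp z) := by
  induction i with
  | zero =>
    have h := NormedSpace.expSeries_div_hasSum_exp z
    rw [← Real.exp_eq_exp_ℝ] at h
    simpa using h
  | succ i ih =>
    rw [← hasSum_nat_add_iff' 1]
    simp only [Finset.range_one, Finset.sum_singleton, Nat.zero_descFactorial_succ,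
      CharP.cast_eq_zero, zero_mul, sub_zero]
    have h := ih.mul_left z
    rw [show z ^ (i + 1) * Real.exp z = z * (z ^ i * Real.exp z) by ring]
    refine h.congr_fun fun m => ?_
    rw [Nat.succ_descFactorial_succ, Nat.factorial_succ]
    push_cast
    have : (m ! : ℝ) ≠ 0 := by exact_mod_cast Nat.factorial_ne_zero _
    field_simp
    ring

/-- Expand `(m+2)(m+1)` in falling factorials: `m(m-1) + 4m + 2`. At `z = -x` the polynomial is `2
L_2(x)`, with `L_2` the Laguerre polynomial; the analogue below gives `6 L_3(x)`. -/
theorem hasSum_factorial_two (z : ℝ) :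
    HasSum (fun m : ℕ => ((m + 2) ! : ℝ) / (m ! : ℝ) ^ 2 * z ^ m)
      ((z ^ 2 + 4 * z + 2) * Real.exp z) := by
  have h0 := hasSum_descFactorial_mul_pow_div_factorial 0 z
  have h1 := hasSum_descFactorial_mul_pow_div_factorial 1 z
  have h2 := hasSum_descFactorial_mul_pow_div_factorial 2 z
  have h := (h2.add (h1.mul_left 4)).add (h0.mul_left 2)
  rw [show (z ^ 2 + 4 * z + 2) * Real.exp z = z ^ 2 * Real.exp z + 4 * (z ^ 1 * Real.exp z)
    + 2 * (z ^ 0 * Real.exp z) by ring]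
  refine h.congr_fun fun m => ?_
  have hm : (m ! : ℝ) ≠ 0 := by exact_mod_cast Nat.factorial_ne_zero _
  have e2 : (m.descFactorial 2 : ℝ) = m * (m - 1) := by
    rw [Nat.cast_descFactorial_two]
  rw [e2]
  simp only [Nat.factorial_succ, Nat.descFactorial_one, Nat.descFactorial_zero]
  push_cast
  field_simp
  ring

theorem cast_descFactorial_three (m : ℕ) :
    (m.descFactorial 3 : ℝ) = m * (m - 1) * (m - 2) := by
  rcases m with _ | _ | m
  · simp
  · simp [Nat.descFactorial]
  · simp [Nat.descFactorial]; ring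

theorem hasSum_factorial_three (z : ℝ) :
    HasSum (fun m : ℕ => ((m + 3) ! : ℝ) / (m ! : ℝ) ^ 2 * z ^ m)
      ((z ^ 3 + 9 * z ^ 2 + 18 * z + 6) * Real.exp z) := by
  have h0 := hasSum_descFactorial_mul_pow_div_factorial 0 z
  have h1 := hasSum_descFactorial_mul_pow_div_factorial 1 z
  have h2 := hasSum_descFactorial_mul_pow_div_factorial 2 z
  have h3 := hasSum_descFactorial_mul_pow_div_factorial 3 z
  have h := ((h3.add (h2.mul_left 9)).add (h1.mul_left 18)).add (h0.mul_left 6)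
  rw [show (z ^ 3 + 9 * z ^ 2 + 18 * z + 6) * Real.exp z = z ^ 3 * Real.exp z +
    9 * (z ^ 2 * Real.exp z) + 18 * (z ^ 1 * Real.exp z) + 6 * (z ^ 0 * Real.exp z) by ring]
  refine h.congr_fun fun m => ?_
  have hm : (m ! : ℝ) ≠ 0 := by exact_mod_cast Nat.factorial_ne_zero _
  have e2 : (m.descFactorial 2 : ℝ) = m * (m - 1) := by
    rw [Nat.cast_descFactorial_two]
  rw [e2, cast_descFactorial_three]
  simp only [Nat.factorial_succ, Nat.descFactorial_one, Nat.descFactorial_zero]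
  push_cast
  field_simp
  ring

theorem hasSum_factorial_zero (z : ℝ) :
    HasSum (fun m : ℕ => ((m + 0) ! : ℝ) / (m ! : ℝ) ^ 2 * z ^ m) (Real.exp z) := by
  have h0 := hasSum_descFactorial_mul_pow_div_factorial 0 z
  rw [pow_zero, one_mul] at h0
  refine h0.congr_fun fun m => ?_
  have hm : (m ! : ℝ) ≠ 0 := by exact_mod_cast Nat.factorial_ne_zero _
  simp only [Nat.descFactorial_zero, add_zero]
  push_cast
  field_simp

theorem integrableOn_pow_mul_exp_neg {b : ℝ} (hb : 0 < b) (k : ℕ) :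
    IntegrableOn (fun y : ℝ => y ^ k * Real.exp (-(b * y))) (Set.Ioi 0) := by
  have h := integrableOn_rpow_mul_exp_neg_mul_rpow (p := 1) (s := k) (b := b)
    (by have : (0 : ℝ) ≤ k := by positivity
        linarith) one_pos hb
  refine h.congr_fun (fun y _ => ?_) measurableSet_Ioi
  simp

theorem integral_pow_mul_exp_neg {b : ℝ} (hb : 0 < b) (k : ℕ) :
    ∫ y in Set.Ioi (0 : ℝ), y ^ k * Real.exp (-(b * y)) = (k ! : ℝ) / b ^ (k + 1) := by
  have h := Real.integral_rpow_mul_exp_neg_mul_Ioi (a := k + 1) (r := b) (by positivity) hb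
  rw [Real.Gamma_nat_eq_factorial] at h
  simp only [add_sub_cancel_right, Real.rpow_natCast] at h
  rw [h, show ((k : ℝ) + 1) = ((k + 1 : ℕ) : ℝ) by push_cast; rfl, Real.rpow_natCast,
    one_div, inv_pow, inv_mul_eq_div]

/-- Integrate the series of `B_0` term by term against the Gamma integrals. The integrals of the
absolute values sum to the same series at `|c|/b`, which justifies the exchange. -/
theorem integral_pow_mul_exp_mul_besselClifford {b c : ℝ} (hb : 0 < b) (k : ℕ)
    {P : ℝ → ℝ} (hP : ∀ z, HasSum (fun m : ℕ => ((m + k) ! : ℝ) / (m ! : ℝ) ^ 2 * z ^ m) (P z)) :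
    ∫ y in Set.Ioi (0 : ℝ), y ^ k * Real.exp (-(b * y)) * besselClifford 0 (c * y) =
      P (-(c / b)) / b ^ (k + 1) := by
  set F : ℕ → ℝ → ℝ := fun m y =>
    (-c) ^ m / (m ! : ℝ) ^ 2 * (y ^ (m + k) * Real.exp (-(b * y))) with hF
  have hFint : ∀ m, IntegrableOn (F m) (Set.Ioi 0) := fun m =>
    (integrableOn_pow_mul_exp_neg hb (m + k)).const_mul _
  have hval : ∀ d : ℝ, ∀ m : ℕ, d ^ m / (m ! : ℝ) ^ 2 * (((m + k) ! : ℝ) / b ^ (m + k + 1)) =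
      ((m + k) ! : ℝ) / (m ! : ℝ) ^ 2 * (d / b) ^ m / b ^ (k + 1) := fun d m => by
    rw [div_pow]
    have hm : (m ! : ℝ) ≠ 0 := by exact_mod_cast Nat.factorial_ne_zero _
    field_simp
    ring
  have hnorm : ∀ m, ∫ y in Set.Ioi (0 : ℝ), ‖F m y‖ =
      ((m + k) ! : ℝ) / (m ! : ℝ) ^ 2 * (|c| / b) ^ m / b ^ (k + 1) := fun m => by
    rw [← hval, ← integral_pow_mul_exp_neg hb, ← integral_const_mul]
    refine setIntegral_congr_fun measurableSet_Ioi fun y hy => ?_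
    have hy' : 0 < y := hy
    simp only [hF, norm_mul, norm_div, norm_pow, norm_neg, Real.norm_eq_abs, Real.abs_exp,
      abs_of_pos hy', Nat.abs_cast]
  have hsum := hasSum_integral_of_summable_integral_norm (μ := volume.restrict (Set.Ioi 0)) hFint
    (by simp_rw [hnorm]; exact ((hP _).summable).div_const _)
  have hint : ∀ m, ∫ y in Set.Ioi (0 : ℝ), F m y =
      ((m + k) ! : ℝ) / (m ! : ℝ) ^ 2 * (-(c / b)) ^ m / b ^ (k + 1) := fun m => by
    rw [show -(c / b) = -c / b by ring, ← hval, ← integral_pow_mul_exp_neg hb,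
      ← integral_const_mul]
  simp_rw [hint] at hsum
  rw [← hsum.unique ((hP (-(c / b))).div_const _)]
  refine setIntegral_congr_fun measurableSet_Ioi fun y _ => ?_
  show y ^ k * Real.exp (-(b * y)) * besselClifford 0 (c * y) = ∑' m, F m y
  rw [besselClifford, ← tsum_mul_left]
  refine tsum_congr fun m => ?_
  simp only [hF, add_zero]
  rw [show -(c * y) = -c * y by ring, mul_pow, pow_add]
  ring

theorem integrableOn_pow_mul_exp_mul_besselClifford {b c : ℝ} (hb : 0 < b) (hc : 0 ≤ c) (k : ℕ) :
    IntegrableOn (fun y : ℝ => y ^ k * Real.exp (-(b * y)) * besselClifford 0 (c * y))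
      (Set.Ioi 0) := by
  refine (integrableOn_pow_mul_exp_neg hb k).mono' ?_ ?_
  · have := continuous_besselClifford 0
    exact Continuous.aestronglyMeasurable (by fun_prop)
  · refine (ae_restrict_iff' measurableSet_Ioi).2 (Eventually.of_forall fun y hy => ?_)
    have hy' : 0 < y := hy
    rw [norm_mul, Real.norm_of_nonneg (by positivity)]
    exact mul_le_of_le_one_right (by positivity) (abs_besselClifford_zero_le_one (by positivity))

end Laplace

/-! ### The Hankel transform of powers of the Bessel–Clifford function of order one -/

/-- The normalized volume of the diagonal section of the polydisc, as a Hankel transform. -/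
noncomputable def diagonalIntegral (n : ℕ) (t : ℝ) : ℝ :=
  n * ∫ y in Set.Ioi (0 : ℝ), besselClifford 1 y ^ n * besselClifford 0 (n * t ^ 2 * y)

section DiagonalIntegral

open MeasureTheory

theorem abs_besselClifford_one_le_sqrt {y : ℝ} (hy : 3 ≤ y) :
    |besselClifford 1 y| ≤ 117 / 500 * √(3 / y) := by
  have h := besselClifford_zero_sq_add_le hy
  have hy0 : 0 < y := by linarith
  refine abs_le_of_sq_le_sq ?_ (by positivity)
  rw [mul_pow, Real.sq_sqrt (by positivity), mul_div_assoc', le_div_iff₀ hy0]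
  nlinarith [sq_nonneg (besselClifford 0 y)]

theorem sqrt_three_div_pow_five {y : ℝ} (hy : 0 < y) :
    √(3 / y) ^ 5 = 3 ^ (5 / 2 : ℝ) * y ^ (-5 / 2 : ℝ) := by
  rw [Real.sqrt_eq_rpow, ← Real.rpow_natCast, ← Real.rpow_mul (by positivity),
    Real.div_rpow (by norm_num) hy.le, div_eq_mul_inv, ← Real.rpow_neg hy.le]
  norm_num

theorem integrableOn_sqrt_three_div_pow_five :
    IntegrableOn (fun y : ℝ => √(3 / y) ^ 5) (Set.Ioi 3) := by
  have h := (integrableOn_Ioi_rpow_of_lt (a := -5 / 2) (c := 3) (by norm_num)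
    (by norm_num)).const_mul (3 ^ (5 / 2 : ℝ))
  refine IntegrableOn.congr_fun h (fun y hy => ?_) measurableSet_Ioi
  exact (sqrt_three_div_pow_five (lt_trans (by norm_num) hy)).symm

theorem integral_sqrt_three_div_pow_five :
    ∫ y in Set.Ioi (3 : ℝ), √(3 / y) ^ 5 = 2 := by
  have h : ∫ y in Set.Ioi (3 : ℝ), √(3 / y) ^ 5 =
      ∫ y in Set.Ioi (3 : ℝ), 3 ^ (5 / 2 : ℝ) * y ^ (-5 / 2 : ℝ) :=
    setIntegral_congr_fun measurableSet_Ioi fun y hy =>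
      sqrt_three_div_pow_five (lt_trans (by norm_num) hy)
  rw [h, integral_const_mul, integral_Ioi_rpow_of_lt (by norm_num) (by norm_num)]
  have e : (3 : ℝ) ^ (5 / 2 : ℝ) * (3 : ℝ) ^ (-5 / 2 + 1 : ℝ) = 3 := by
    rw [← Real.rpow_add (by norm_num)]; norm_num
  linear_combination (2 / 3 : ℝ) * e

/-- Only five of the `n` factors `√(3/y)` are kept: they make the tail integrable, with integral `2`
whatever `n` is, while the constant decays geometrically. -/
theorem abs_besselClifford_one_pow_le {n : ℕ} (hn : 5 ≤ n) {y : ℝ} (hy : 3 ≤ y) :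
    |besselClifford 1 y| ^ n ≤ (117 / 500) ^ n * √(3 / y) ^ 5 := by
  refine (pow_le_pow_left₀ (abs_nonneg _) (abs_besselClifford_one_le_sqrt hy) n).trans ?_
  rw [mul_pow]
  have h1 : √(3 / y) ≤ 1 := by
    rw [Real.sqrt_le_one, div_le_one (by linarith)]; exact hy
  exact mul_le_mul_of_nonneg_left (pow_le_pow_of_le_one (Real.sqrt_nonneg _) h1 hn) (by positivity)

theorem tail_constant_le {n : ℕ} (hn : 5 ≤ n) : (n : ℝ) ^ 3 * (117 / 500) ^ n ≤ 88 / 1000 := by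
  induction n, hn using Nat.le_induction with
  | base => norm_num
  | succ n hn ih =>
    have hn' : (5 : ℝ) ≤ n := by exact_mod_cast hn
    refine le_trans ?_ ih
    rw [pow_succ (117 / 500 : ℝ)]
    push_cast
    have h : ((n : ℝ) + 1) ^ 3 * (117 / 500) ≤ (n : ℝ) ^ 3 := by
      have h3 : (n : ℝ) + 1 ≤ 6 / 5 * n := by linarith
      calc ((n : ℝ) + 1) ^ 3 * (117 / 500) ≤ (6 / 5 * n) ^ 3 * (117 / 500) := by gcongr
        _ ≤ (n : ℝ) ^ 3 := by nlinarith [pow_pos (by linarith : (0 : ℝ) < n) 3]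
    calc ((n : ℝ) + 1) ^ 3 * ((117 / 500) ^ n * (117 / 500))
        = ((n : ℝ) + 1) ^ 3 * (117 / 500) * (117 / 500) ^ n := by ring
      _ ≤ (n : ℝ) ^ 3 * (117 / 500) ^ n := by gcongr

variable {n : ℕ} {t : ℝ}

theorem continuous_diagonal_integrand (n : ℕ) (c : ℝ) :
    Continuous fun y => besselClifford 1 y ^ n * besselClifford 0 (c * y) := by
  have := continuous_besselClifford 0
  have := continuous_besselClifford 1
  fun_prop

theorem integrableOn_diagonal_Ioc (n : ℕ) (c : ℝ) :
    IntegrableOn (fun y => besselClifford 1 y ^ n * besselClifford 0 (c * y)) (Set.Ioc 0 3) :=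
  ((continuous_diagonal_integrand n c).continuousOn.integrableOn_Icc).mono_set
    Set.Ioc_subset_Icc_self

theorem norm_diagonal_integrand_le (hn : 5 ≤ n) {c M y : ℝ} (hy : 3 ≤ y)
    (hM : |besselClifford 0 (c * y)| ≤ M) :
    ‖besselClifford 1 y ^ n * besselClifford 0 (c * y)‖ ≤
      M * (117 / 500) ^ n * √(3 / y) ^ 5 := by
  rw [norm_mul, norm_pow, Real.norm_eq_abs, Real.norm_eq_abs]
  calc |besselClifford 1 y| ^ n * |besselClifford 0 (c * y)|
      ≤ ((117 / 500) ^ n * √(3 / y) ^ 5) * M := by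
        gcongr
        exact abs_besselClifford_one_pow_le hn hy
    _ = _ := by ring

theorem integrableOn_diagonal_Ioi_three (hn : 5 ≤ n) {c : ℝ} (hc : 0 ≤ c) :
    IntegrableOn (fun y => besselClifford 1 y ^ n * besselClifford 0 (c * y)) (Set.Ioi 3) := by
  refine (integrableOn_sqrt_three_div_pow_five.const_mul (1 * (117 / 500) ^ n)).mono'
    (continuous_diagonal_integrand n c).aestronglyMeasurable ?_
  refine (ae_restrict_iff' measurableSet_Ioi).2 (Eventually.of_forall fun y hy => ?_)
  have hy' : 3 < y := hy
  exact norm_diagonal_integrand_le hn hy'.le (abs_besselClifford_zero_le_one (by positivity))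

theorem abs_integral_diagonal_tail_le (hn : 5 ≤ n) {c M : ℝ}
    (hM : ∀ y, 3 ≤ y → |besselClifford 0 (c * y)| ≤ M) :
    |∫ y in Set.Ioi (3 : ℝ), besselClifford 1 y ^ n * besselClifford 0 (c * y)| ≤
      2 * M * (117 / 500) ^ n := by
  have h := norm_integral_le_of_norm_le (μ := volume.restrict (Set.Ioi (3 : ℝ)))
    (integrableOn_sqrt_three_div_pow_five.const_mul (M * (117 / 500) ^ n))
    ((ae_restrict_iff' measurableSet_Ioi).2 (Eventually.of_forall fun y hy =>
      norm_diagonal_integrand_le hn (le_of_lt hy) (hM y (le_of_lt hy))))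
  rw [integral_const_mul, integral_sqrt_three_div_pow_five] at h
  refine h.trans (le_of_eq ?_)
  ring

/-- The integrand is bounded below by the product of `exp (-n y / 2)` with a polynomial. -/
theorem diagonal_minorant_le (hn : 5 ≤ n) {y J : ℝ} (hy : 0 ≤ y) (hy3 : y ≤ 3)
    (hJ : -(81 / 200) ≤ J) :
    Real.exp (-(n * y / 2)) * ((1 - n * y ^ 2 / 24 - n * y ^ 3 / 144) * J -
      81 / 200 * ((n * y ^ 2 / 24) ^ 2 / 2 + 11 / 20 * (n * y ^ 3 / 144))) ≤
      besselClifford 1 y ^ n * J := by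
  -- Since `J` may be negative, write `B_1^n J = B_1^n (J + 81/200) - (81/200) B_1^n`, using the
  -- lower bound on `B_1^n` in the first product and the upper bound in the second.
  have h1 := mul_le_mul_of_nonneg_right (le_besselClifford_one_pow hn hy hy3)
    (by linarith : 0 ≤ J + 81 / 200)
  have h2 := besselClifford_one_pow_le (n := n) hy hy3
  nlinarith

/-- Lets the minorant be integrated over the whole half-line, where its Laplace transform is
explicit, instead of over `(0, 3]`. -/
theorem diagonal_minorant_nonpos (hn : 5 ≤ n) {y J : ℝ} (hy : 3 ≤ y) (hJ : -(81 / 200) ≤ J) :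
    Real.exp (-(n * y / 2)) * ((1 - n * y ^ 2 / 24 - n * y ^ 3 / 144) * J -
      81 / 200 * ((n * y ^ 2 / 24) ^ 2 / 2 + 11 / 20 * (n * y ^ 3 / 144))) ≤ 0 := by
  refine mul_nonpos_of_nonneg_of_nonpos (Real.exp_pos _).le ?_
  have hn' : (5 : ℝ) ≤ n := by exact_mod_cast hn
  obtain ⟨q, hq⟩ : ∃ q, q = n * y ^ 2 / 24 := ⟨_, rfl⟩
  have hr : n * y ^ 3 / 144 = q * y / 6 := by rw [hq]; ring
  have hy2 : y ≤ 8 / 5 * q := by rw [hq]; nlinarith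
  have hq0 : 15 / 8 ≤ q := by linarith
  rw [hr, ← hq]
  have h1 : 0 ≤ (q + q * y / 6 - 1) * (J + 81 / 200) :=
    mul_nonneg (by nlinarith) (by linarith)
  have h2 : q * y ≤ 8 / 5 * q ^ 2 := by nlinarith
  nlinarith [sq_nonneg (q - 1)]

/-- The constant `837/2000 = 0.27 + 0.1485` comes from the quartic and cubic error terms of the
minorant, and `22/125 = 2 · 0.088` from the tail past `3`. `M` stays free because a bound better
than `1` is needed for `t` near `t₀`. -/
theorem diagonalIntegral_ge (hn : 5 ≤ n) (t : ℝ) {M : ℝ} (hM0 : 0 ≤ M)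
    (hM : ∀ y, 3 ≤ y → |besselClifford 0 (n * t ^ 2 * y)| ≤ M) :
    2 * Real.exp (-(2 * t ^ 2)) * (1 - ((2 * t ^ 2) ^ 2 - 4 * (2 * t ^ 2) + 2) / (6 * n) -
      (-(2 * t ^ 2) ^ 3 + 9 * (2 * t ^ 2) ^ 2 - 18 * (2 * t ^ 2) + 6) / (18 * n ^ 2))
      - (837 / 2000 + 22 / 125 * M) / n ^ 2 ≤ diagonalIntegral n t := by
  have hn' : (5 : ℝ) ≤ n := by exact_mod_cast hn
  have hn0 : (0 : ℝ) < n := by linarith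
  set c := n * t ^ 2 with hc
  have hc0 : 0 ≤ c := by positivity
  have hb : (0 : ℝ) < n / 2 := by positivity
  have hcb : -(c / (n / 2)) = -(2 * t ^ 2) := by rw [hc]; field_simp
  have i0 := integrableOn_pow_mul_exp_mul_besselClifford hb hc0 0
  have i2 := integrableOn_pow_mul_exp_mul_besselClifford hb hc0 2
  have i3 := integrableOn_pow_mul_exp_mul_besselClifford hb hc0 3
  have k3 := integrableOn_pow_mul_exp_neg hb 3
  have k4 := integrableOn_pow_mul_exp_neg hb 4
  have v0 := integral_pow_mul_exp_mul_besselClifford (c := c) hb 0 hasSum_factorial_zero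
  have v2 := integral_pow_mul_exp_mul_besselClifford (c := c) hb 2 hasSum_factorial_two
  have v3 := integral_pow_mul_exp_mul_besselClifford (c := c) hb 3 hasSum_factorial_three
  have w3 := integral_pow_mul_exp_neg hb 3
  have w4 := integral_pow_mul_exp_neg hb 4
  rw [hcb] at v0 v2 v3
  set g : ℝ → ℝ := fun y => Real.exp (-(n * y / 2)) *
    ((1 - n * y ^ 2 / 24 - n * y ^ 3 / 144) * besselClifford 0 (c * y) -
      81 / 200 * ((n * y ^ 2 / 24) ^ 2 / 2 + 11 / 20 * (n * y ^ 3 / 144))) with hg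
  have hg' : g = fun y =>
      ((((y ^ 0 * Real.exp (-(n / 2 * y)) * besselClifford 0 (c * y))
      - n / 24 * (y ^ 2 * Real.exp (-(n / 2 * y)) * besselClifford 0 (c * y)))
      - n / 144 * (y ^ 3 * Real.exp (-(n / 2 * y)) * besselClifford 0 (c * y)))
      - 81 * n ^ 2 / 230400 * (y ^ 4 * Real.exp (-(n / 2 * y))))
      - 891 * n / 576000 * (y ^ 3 * Real.exp (-(n / 2 * y))) := by
    funext y
    rw [hg, show (n : ℝ) / 2 * y = n * y / 2 by ring]
    ring
  have j1 := i0.sub (i2.const_mul ((n : ℝ) / 24))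
  have j2 := j1.sub (i3.const_mul ((n : ℝ) / 144))
  have j3 := j2.sub (k4.const_mul (81 * (n : ℝ) ^ 2 / 230400))
  have hgi : IntegrableOn g (Set.Ioi 0) := by
    rw [hg']
    exact j3.sub (k3.const_mul (891 * (n : ℝ) / 576000))
  have hgv : ∫ y in Set.Ioi (0 : ℝ), g y = Real.exp (-(2 * t ^ 2)) / (n / 2) ^ (0 + 1)
      - n / 24 * ((((-(2 * t ^ 2)) ^ 2 + 4 * (-(2 * t ^ 2)) + 2) * Real.exp (-(2 * t ^ 2))) /
        (n / 2) ^ (2 + 1))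
      - n / 144 * ((((-(2 * t ^ 2)) ^ 3 + 9 * (-(2 * t ^ 2)) ^ 2 + 18 * (-(2 * t ^ 2)) + 6) *
        Real.exp (-(2 * t ^ 2))) / (n / 2) ^ (3 + 1))
      - 81 * n ^ 2 / 230400 * ((Nat.factorial 4 : ℝ) / (n / 2) ^ (4 + 1))
      - 891 * n / 576000 * ((Nat.factorial 3 : ℝ) / (n / 2) ^ (3 + 1)) := by
    rw [hg']
    have s4 := integral_sub j3 (k3.const_mul (891 * (n : ℝ) / 576000))
    have s3 := integral_sub j2 (k4.const_mul (81 * (n : ℝ) ^ 2 / 230400))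
    have s2 := integral_sub j1 (i3.const_mul ((n : ℝ) / 144))
    have s1 := integral_sub i0 (i2.const_mul ((n : ℝ) / 24))
    simp only [Pi.sub_apply] at s1 s2 s3 s4
    rw [s4, s3, s2, s1]
    simp only [integral_const_mul]
    rw [v0, v2, v3, w3, w4]
  have hJ : ∀ y, 0 ≤ y → -(81 / 200) ≤ besselClifford 0 (c * y) := fun y hy =>
    neg_le_besselClifford_zero (by positivity)
  have hle : ∫ y in Set.Ioi (0 : ℝ), g y ≤
      ∫ y in Set.Ioc (0 : ℝ) 3, besselClifford 1 y ^ n * besselClifford 0 (c * y) := by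
    have hs : Set.Ioi (0 : ℝ) = Set.Ioc 0 3 ∪ Set.Ioi 3 :=
      (Set.Ioc_union_Ioi_eq_Ioi (by norm_num)).symm
    have h1 : ∫ y in Set.Ioi (0 : ℝ), g y =
        (∫ y in Set.Ioc (0 : ℝ) 3, g y) + ∫ y in Set.Ioi (3 : ℝ), g y := by
      conv_lhs => rw [hs]
      exact setIntegral_union Set.Ioc_disjoint_Ioi_same measurableSet_Ioi
        (hgi.mono_set (by rw [hs]; exact Set.subset_union_left))
        (hgi.mono_set (by rw [hs]; exact Set.subset_union_right))
    have h2 : ∫ y in Set.Ioi (3 : ℝ), g y ≤ 0 :=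
      setIntegral_nonpos measurableSet_Ioi fun y hy =>
        diagonal_minorant_nonpos hn (le_of_lt hy)
          (hJ y ((by norm_num : (0 : ℝ) ≤ 3).trans (le_of_lt hy)))
    have h3 : ∫ y in Set.Ioc (0 : ℝ) 3, g y ≤
        ∫ y in Set.Ioc (0 : ℝ) 3, besselClifford 1 y ^ n * besselClifford 0 (c * y) :=
      setIntegral_mono_on (hgi.mono_set (by rw [hs]; exact Set.subset_union_left))
        (integrableOn_diagonal_Ioc n c) measurableSet_Ioc fun y hy =>
        diagonal_minorant_le hn hy.1.le hy.2 (hJ y hy.1.le)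
    linarith
  have htail := (abs_le.1 (abs_integral_diagonal_tail_le hn hM)).1
  have hsplit : ∫ y in Set.Ioi (0 : ℝ), besselClifford 1 y ^ n * besselClifford 0 (c * y) =
      (∫ y in Set.Ioc (0 : ℝ) 3, besselClifford 1 y ^ n * besselClifford 0 (c * y)) +
      ∫ y in Set.Ioi (3 : ℝ), besselClifford 1 y ^ n * besselClifford 0 (c * y) := by
    rw [← Set.Ioc_union_Ioi_eq_Ioi (by norm_num : (0 : ℝ) ≤ 3)]
    exact setIntegral_union Set.Ioc_disjoint_Ioi_same measurableSet_Ioi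
      (integrableOn_diagonal_Ioc n c) (integrableOn_diagonal_Ioi_three hn hc0)
  have hconst := tail_constant_le hn
  have hfin : n * (∫ y in Set.Ioi (0 : ℝ), g y) - n * (2 * M * (117 / 500) ^ n) ≤
      diagonalIntegral n t := by
    rw [diagonalIntegral, ← hc, hsplit, ← mul_sub]
    gcongr
    linarith
  refine le_trans ?_ hfin
  rw [hgv]
  have ht : n * (2 * M * (117 / 500) ^ n) ≤ 22 / 125 * M / n ^ 2 := by
    rw [le_div_iff₀ (by positivity)]
    nlinarith
  have hmain : n * (Real.exp (-(2 * t ^ 2)) / (n / 2) ^ (0 + 1)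
      - n / 24 * ((((-(2 * t ^ 2)) ^ 2 + 4 * (-(2 * t ^ 2)) + 2) * Real.exp (-(2 * t ^ 2))) /
        (n / 2) ^ (2 + 1))
      - n / 144 * ((((-(2 * t ^ 2)) ^ 3 + 9 * (-(2 * t ^ 2)) ^ 2 + 18 * (-(2 * t ^ 2)) + 6) *
        Real.exp (-(2 * t ^ 2))) / (n / 2) ^ (3 + 1))
      - 81 * n ^ 2 / 230400 * ((Nat.factorial 4 : ℝ) / (n / 2) ^ (4 + 1))
      - 891 * n / 576000 * ((Nat.factorial 3 : ℝ) / (n / 2) ^ (3 + 1))) =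
      2 * Real.exp (-(2 * t ^ 2)) * (1 - ((2 * t ^ 2) ^ 2 - 4 * (2 * t ^ 2) + 2) / (6 * n) -
      (-(2 * t ^ 2) ^ 3 + 9 * (2 * t ^ 2) ^ 2 - 18 * (2 * t ^ 2) + 6) / (18 * n ^ 2))
      - 837 / 2000 / n ^ 2 := by
    norm_num [Nat.factorial]
    field_simp
    ring
  rw [hmain, add_div (837 / 2000 : ℝ)]
  linarith

end DiagonalIntegral

/-! ### Upper bound for the diagonal integral and its Gaussian limit. -/

section DiagonalIntegralLimit

open MeasureTheory

variable {n : ℕ}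

/-- With `E = exp(-n y/2) ≥ B_1^n` and `J ≥ -1`, one has `B_1^n J ≤ E J + (E - B_1^n)`. This crude
bound serves only for the limit. -/
theorem diagonal_le_majorant (hn : 5 ≤ n) {y J : ℝ} (hy : 0 ≤ y) (hy3 : y ≤ 3) (hJ : |J| ≤ 1) :
    besselClifford 1 y ^ n * J ≤
      Real.exp (-(n * y / 2)) * (J + n * y ^ 2 / 24 + n * y ^ 3 / 144) := by
  have h1 := le_besselClifford_one_pow hn hy hy3
  have h2 : besselClifford 1 y ^ n ≤ Real.exp (-(n * y / 2)) := by
    refine (pow_le_pow_left₀ (besselClifford_one_pos hy hy3).le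
      (besselClifford_one_le_exp hy hy3) n).trans ?_
    rw [← Real.exp_nat_mul]
    refine Real.exp_le_exp.2 ?_
    have : 0 ≤ (n : ℝ) * (y ^ 2 / 24 + y ^ 3 / 144) := by positivity
    linarith
  have h3 := mul_le_mul_of_nonneg_left (neg_le_of_abs_le hJ) (sub_nonneg.2 h2)
  linarith

theorem diagonal_majorant_nonneg (hn : 5 ≤ n) {y J : ℝ} (hy3 : 3 ≤ y) (hJ : |J| ≤ 1) :
    0 ≤ Real.exp (-(n * y / 2)) * (J + n * y ^ 2 / 24 + n * y ^ 3 / 144) := by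
  refine mul_nonneg (Real.exp_pos _).le ?_
  have hn' : (5 : ℝ) ≤ n := by exact_mod_cast hn
  have h1 : 0 ≤ n * y ^ 3 / 144 := by positivity
  have h2 : (5 : ℝ) * 3 ^ 2 / 24 ≤ n * y ^ 2 / 24 := by gcongr
  linarith [neg_le_of_abs_le hJ]

theorem diagonalIntegral_le (hn : 5 ≤ n) (t : ℝ) :
    diagonalIntegral n t ≤ 2 * Real.exp (-(2 * t ^ 2)) + 2 / n := by
  have hn' : (5 : ℝ) ≤ n := by exact_mod_cast hn
  have hn0 : (0 : ℝ) < n := by linarith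
  set c := n * t ^ 2 with hc
  have hc0 : 0 ≤ c := by positivity
  have hb : (0 : ℝ) < n / 2 := by positivity
  have hcb : -(c / (n / 2)) = -(2 * t ^ 2) := by rw [hc]; field_simp
  have i0 := integrableOn_pow_mul_exp_mul_besselClifford hb hc0 0
  have k2 := integrableOn_pow_mul_exp_neg hb 2
  have k3 := integrableOn_pow_mul_exp_neg hb 3
  have v0 := integral_pow_mul_exp_mul_besselClifford (c := c) hb 0 hasSum_factorial_zero
  have w2 := integral_pow_mul_exp_neg hb 2
  have w3 := integral_pow_mul_exp_neg hb 3
  rw [hcb] at v0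
  set g : ℝ → ℝ := fun y => Real.exp (-(n * y / 2)) *
    (besselClifford 0 (c * y) + n * y ^ 2 / 24 + n * y ^ 3 / 144) with hg
  have hg' : g = fun y =>
      ((y ^ 0 * Real.exp (-(n / 2 * y)) * besselClifford 0 (c * y))
      + n / 24 * (y ^ 2 * Real.exp (-(n / 2 * y))))
      + n / 144 * (y ^ 3 * Real.exp (-(n / 2 * y))) := by
    funext y
    rw [hg, show (n : ℝ) / 2 * y = n * y / 2 by ring]
    ring
  have j1 := i0.add (k2.const_mul ((n : ℝ) / 24))
  have hgi : IntegrableOn g (Set.Ioi 0) := by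
    rw [hg']
    exact j1.add (k3.const_mul ((n : ℝ) / 144))
  have hgv : ∫ y in Set.Ioi (0 : ℝ), g y = Real.exp (-(2 * t ^ 2)) / (n / 2) ^ (0 + 1)
      + n / 24 * ((Nat.factorial 2 : ℝ) / (n / 2) ^ (2 + 1))
      + n / 144 * ((Nat.factorial 3 : ℝ) / (n / 2) ^ (3 + 1)) := by
    rw [hg']
    have s2 := integral_add j1 (k3.const_mul ((n : ℝ) / 144))
    have s1 := integral_add i0 (k2.const_mul ((n : ℝ) / 24))
    simp only [Pi.add_apply] at s1 s2
    rw [s2, s1]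
    simp only [integral_const_mul]
    rw [v0, w2, w3]
  have hJ : ∀ y, 0 ≤ y → |besselClifford 0 (c * y)| ≤ 1 := fun y hy =>
    abs_besselClifford_zero_le_one (by positivity)
  have hs : Set.Ioi (0 : ℝ) = Set.Ioc 0 3 ∪ Set.Ioi 3 :=
    (Set.Ioc_union_Ioi_eq_Ioi (by norm_num)).symm
  have hle : ∫ y in Set.Ioc (0 : ℝ) 3, besselClifford 1 y ^ n * besselClifford 0 (c * y) ≤
      ∫ y in Set.Ioi (0 : ℝ), g y := by
    have h1 : ∫ y in Set.Ioi (0 : ℝ), g y =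
        (∫ y in Set.Ioc (0 : ℝ) 3, g y) + ∫ y in Set.Ioi (3 : ℝ), g y := by
      conv_lhs => rw [hs]
      exact setIntegral_union Set.Ioc_disjoint_Ioi_same measurableSet_Ioi
        (hgi.mono_set (by rw [hs]; exact Set.subset_union_left))
        (hgi.mono_set (by rw [hs]; exact Set.subset_union_right))
    have h2 : 0 ≤ ∫ y in Set.Ioi (3 : ℝ), g y :=
      setIntegral_nonneg measurableSet_Ioi fun y hy =>
        diagonal_majorant_nonneg hn (le_of_lt hy)
          (hJ y ((by norm_num : (0 : ℝ) ≤ 3).trans (le_of_lt hy)))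
    have h3 : ∫ y in Set.Ioc (0 : ℝ) 3, besselClifford 1 y ^ n * besselClifford 0 (c * y) ≤
        ∫ y in Set.Ioc (0 : ℝ) 3, g y :=
      setIntegral_mono_on (integrableOn_diagonal_Ioc n c)
        (hgi.mono_set (by rw [hs]; exact Set.subset_union_left)) measurableSet_Ioc fun y hy =>
        diagonal_le_majorant hn hy.1.le hy.2 (hJ y hy.1.le)
    linarith
  have htail := (abs_le.1 (abs_integral_diagonal_tail_le hn (c := c) (M := 1)
    fun y hy => hJ y (by linarith))).2
  have hsplit : ∫ y in Set.Ioi (0 : ℝ), besselClifford 1 y ^ n * besselClifford 0 (c * y) =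
      (∫ y in Set.Ioc (0 : ℝ) 3, besselClifford 1 y ^ n * besselClifford 0 (c * y)) +
      ∫ y in Set.Ioi (3 : ℝ), besselClifford 1 y ^ n * besselClifford 0 (c * y) := by
    rw [hs]
    exact setIntegral_union Set.Ioc_disjoint_Ioi_same measurableSet_Ioi
      (integrableOn_diagonal_Ioc n c) (integrableOn_diagonal_Ioi_three hn hc0)
  have hconst := tail_constant_le hn
  have hfin : diagonalIntegral n t ≤
      n * (∫ y in Set.Ioi (0 : ℝ), g y) + n * (2 * 1 * (117 / 500) ^ n) := by
    rw [diagonalIntegral, ← hc, hsplit, ← mul_add]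
    gcongr
  refine hfin.trans ?_
  rw [hgv]
  have ht : n * (2 * 1 * (117 / 500) ^ n) ≤ 22 / 125 / (n : ℝ) ^ 2 := by
    rw [le_div_iff₀ (by positivity)]
    nlinarith
  have hmain : n * (Real.exp (-(2 * t ^ 2)) / (n / 2) ^ (0 + 1)
      + n / 24 * ((Nat.factorial 2 : ℝ) / (n / 2) ^ (2 + 1))
      + n / 144 * ((Nat.factorial 3 : ℝ) / (n / 2) ^ (3 + 1))) =
      2 * Real.exp (-(2 * t ^ 2)) + 2 / 3 / n + 2 / 3 / n ^ 2 := by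
    norm_num [Nat.factorial]
    field_simp
    ring
  have h2 : 2 / 3 / (n : ℝ) ^ 2 + 22 / 125 / (n : ℝ) ^ 2 ≤ 4 / 3 / n := by
    rw [← add_div, div_le_div_iff₀ (by positivity) (by positivity)]
    nlinarith
  have h3 : 2 / 3 / (n : ℝ) + 4 / 3 / n = 2 / n := by rw [← add_div]; norm_num
  rw [hmain]
  linarith

theorem tendsto_diagonalIntegral (t : ℝ) :
    Tendsto (fun n : ℕ => diagonalIntegral n t) atTop (𝓝 (2 * Real.exp (-2 * t ^ 2))) := by
  have hinv : Tendsto (fun n : ℕ => 1 / (n : ℝ)) atTop (𝓝 0) := tendsto_one_div_atTop_nhds_zero_nat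
  rw [show -2 * t ^ 2 = -(2 * t ^ 2) by ring]
  have hlow : Tendsto (fun n : ℕ => 2 * Real.exp (-(2 * t ^ 2)) *
      (1 - ((2 * t ^ 2) ^ 2 - 4 * (2 * t ^ 2) + 2) / 6 * (1 / (n : ℝ)) -
      (-(2 * t ^ 2) ^ 3 + 9 * (2 * t ^ 2) ^ 2 - 18 * (2 * t ^ 2) + 6) / 18 * (1 / (n : ℝ)) ^ 2)
      - (837 / 2000 + 22 / 125 * 1) * (1 / (n : ℝ)) ^ 2) atTop
      (𝓝 (2 * Real.exp (-(2 * t ^ 2)) * (1 - ((2 * t ^ 2) ^ 2 - 4 * (2 * t ^ 2) + 2) / 6 * 0 -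
      (-(2 * t ^ 2) ^ 3 + 9 * (2 * t ^ 2) ^ 2 - 18 * (2 * t ^ 2) + 6) / 18 * 0 ^ 2)
      - (837 / 2000 + 22 / 125 * 1) * 0 ^ 2)) :=
    (((tendsto_const_nhds.sub (hinv.const_mul _)).sub ((hinv.pow 2).const_mul _)).const_mul _).sub
      ((hinv.pow 2).const_mul _)
  have hup : Tendsto (fun n : ℕ => 2 * Real.exp (-(2 * t ^ 2)) + 2 * (1 / (n : ℝ))) atTop
      (𝓝 (2 * Real.exp (-(2 * t ^ 2)) + 2 * 0)) := (hinv.const_mul _).const_add _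
  norm_num only [mul_zero, sub_zero, add_zero, ne_eq, mul_one, OfNat.ofNat_ne_zero,
    not_false_eq_true, zero_pow] at hlow hup
  refine tendsto_of_tendsto_of_tendsto_of_le_of_le' hlow hup ?_ ?_
  · filter_upwards [eventually_ge_atTop 5] with n hn
    refine le_trans (le_of_eq ?_) (diagonalIntegral_ge hn t zero_le_one fun y hy =>
      abs_besselClifford_zero_le_one (by positivity))
    have hn0 : (n : ℝ) ≠ 0 := by positivity
    field_simp
    ring
  · filter_upwards [eventually_ge_atTop 5] with n hn
    refine (diagonalIntegral_le hn t).trans (le_of_eq ?_)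
    ring

end DiagonalIntegralLimit

/-! ### Sections of the polydisc as volumes in one dimension less -/

section Section

open MeasureTheory Module

theorem EuclideanSpace.complex_real_inner_eq_re {ι : Type*} [Fintype ι]
    (x y : EuclideanSpace ℂ ι) : inner ℝ x y = (inner ℂ x y).re := by
  simp [PiLp.inner_apply, Complex.inner]

/-- Both measures are Haar measures, and they agree on the unit box, a product of unit squares of
`ℂ`. -/
theorem EuclideanSpace.volume_preserving_toLp_complex (ι : Type*) [Fintype ι] [DecidableEq ι] :
    MeasurePreserving (WithLp.toLp 2 : (ι → ℂ) → EuclideanSpace ℂ ι) volume volume := by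
  have hm : Measurable (WithLp.toLp 2 : (ι → ℂ) → EuclideanSpace ℂ ι) :=
    WithLp.measurable_toLp 2 _
  refine ⟨hm, ?_⟩
  let e : (ι → ℂ) ≃L[ℝ] EuclideanSpace ℂ ι := (PiLp.continuousLinearEquiv 2 ℝ fun _ : ι => ℂ).symm
  have he : (WithLp.toLp 2 : (ι → ℂ) → EuclideanSpace ℂ ι) = e := rfl
  let b : OrthonormalBasis ((_ : ι) × Fin 2) ℝ (EuclideanSpace ℂ ι) :=
    Pi.orthonormalBasis fun _ => Complex.orthonormalBasisOneI
  have : (Measure.map (WithLp.toLp 2 : (ι → ℂ) → EuclideanSpace ℂ ι) volume).IsAddHaarMeasure := by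
    rw [he]; infer_instance
  have hbox : ∀ x : ι → ℂ, WithLp.toLp 2 x ∈ parallelepiped b.toBasis ↔
      ∀ i, x i ∈ parallelepiped Complex.orthonormalBasisOneI.toBasis := fun x => by
    rw [parallelepiped_basis_eq, parallelepiped_basis_eq]
    simp only [Set.mem_ofPred_eq, OrthonormalBasis.coe_toBasis_repr_apply]
    exact ⟨fun h i j => h ⟨i, j⟩, fun h ij => h ij.1 ij.2⟩
  have hone : volume (parallelepiped Complex.orthonormalBasisOneI.toBasis) = 1 := by
    rw [OrthonormalBasis.coe_toBasis]
    exact Complex.orthonormalBasisOneI.volume_parallelepiped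
  rw [← b.addHaar_eq_volume, eq_comm, Basis.addHaar_eq_iff,
    Measure.map_apply hm (b.toBasis.parallelepiped.isCompact.measurableSet),
    Basis.coe_parallelepiped]
  have hset : (WithLp.toLp 2 : (ι → ℂ) → EuclideanSpace ℂ ι) ⁻¹' parallelepiped b.toBasis =
      Set.univ.pi fun _ => parallelepiped Complex.orthonormalBasisOneI.toBasis := by
    ext x
    simp only [Set.mem_preimage, hbox, Set.mem_pi, Set.mem_univ, true_imp_iff]
  rw [hset, volume_pi_pi]
  simp only [hone, Finset.prod_const_one]

/-- With `b` the vector of the other coordinates of `a`, `f* f` is the identity plus a rank-one map,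
of complex determinant `1 + ‖b‖²/‖a 0‖² = ‖a 0‖⁻²`. The real determinant is the squared modulus of
this, and `normDet` is its square root. -/
theorem normDet_graph {n : ℕ} (a : EuclideanSpace ℂ (Fin (n + 1))) (ha : ‖a‖ = 1) (h0 : a 0 ≠ 0)
    (f : EuclideanSpace ℂ (Fin n) →ₗ[ℂ] EuclideanSpace ℂ (Fin (n + 1)))
    (hf0 : ∀ w, f w 0 = -(∑ i, starRingEnd ℂ (a i.succ) * w i) / starRingEnd ℂ (a 0))
    (hfs : ∀ w i, f w (Fin.succ i) = w i) :
    (f.restrictScalars ℝ).normDet = (‖a 0‖ ^ 2)⁻¹ := by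
  have hn0 : (0 : ℝ) < ‖a 0‖ := norm_pos_iff.2 h0
  let b : EuclideanSpace ℂ (Fin n) := WithLp.toLp 2 fun i => a i.succ
  have hb : ∀ w, ∑ i, starRingEnd ℂ (a i.succ) * w i = inner ℂ b w := fun w => by
    simp [b, PiLp.inner_apply, mul_comm]
  have hnb : ‖b‖ ^ 2 = 1 - ‖a 0‖ ^ 2 := by
    have h1 := EuclideanSpace.norm_sq_eq a
    rw [ha, Fin.sum_univ_succ] at h1
    rw [EuclideanSpace.norm_sq_eq b]
    simp only [b]
    linarith
  let φ : EuclideanSpace ℂ (Fin n) →ₗ[ℂ] ℂ :=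
    (((‖a 0‖ ^ 2)⁻¹ : ℝ) : ℂ) • (innerSL ℂ b).toLinearMap
  have hφ : ∀ x, φ x = (((‖a 0‖ ^ 2)⁻¹ : ℝ) : ℂ) * inner ℂ b x := fun x => rfl
  have key : LinearMap.adjoint (f.restrictScalars ℝ) ∘ₗ (f.restrictScalars ℝ) =
      (LinearMap.transvection φ b).restrictScalars ℝ := by
    refine LinearMap.ext fun x => ext_inner_right ℝ fun y => ?_
    rw [LinearMap.comp_apply, LinearMap.adjoint_inner_left]
    simp only [LinearMap.restrictScalars_apply, EuclideanSpace.complex_real_inner_eq_re]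
    congr 1
    rw [LinearMap.transvection.apply, inner_add_left, inner_smul_left, hφ,
      PiLp.inner_apply, Fin.sum_univ_succ, hf0, hf0]
    simp only [hfs, hb]
    rw [← PiLp.inner_apply x y, add_comm]
    congr 1
    have h2 : (a 0 : ℂ) * starRingEnd ℂ (a 0) = ((‖a 0‖ ^ 2 : ℝ) : ℂ) := by
      rw [Complex.mul_conj, Complex.normSq_eq_norm_sq]
    have h3 : starRingEnd ℂ (a 0) ≠ 0 := by simpa using h0
    have h4 : ((‖a 0‖ : ℝ) : ℂ) ≠ 0 := by exact_mod_cast hn0.ne'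
    simp only [RCLike.inner_apply, map_div₀, map_neg, map_mul, Complex.conj_ofReal,
      RingHomCompTriple.comp_apply, RingHom.id_apply]
    push_cast at h2 ⊢
    field_simp
    rw [← h2]
    ring
  have h := (f.restrictScalars ℝ).normDet_sq
  rw [key, LinearMap.det_restrictScalars, LinearMap.transvection.det, hφ,
    inner_self_eq_norm_sq_to_K, Algebra.norm_complex_eq] at h
  have h5 : (1 : ℂ) + (((‖a 0‖ ^ 2)⁻¹ : ℝ) : ℂ) * (((‖b‖ : ℝ) : ℂ)) ^ 2 =
      (((‖a 0‖ ^ 2)⁻¹ : ℝ) : ℂ) := by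
    have : (1 : ℝ) + (‖a 0‖ ^ 2)⁻¹ * ‖b‖ ^ 2 = (‖a 0‖ ^ 2)⁻¹ := by
      rw [hnb]; field_simp; ring
    exact_mod_cast this
  have h6 : (f.restrictScalars ℝ).normDet ^ 2 = ((‖a 0‖ ^ 2)⁻¹) ^ 2 := by
    have h7 : (RCLike.ofReal ((f.restrictScalars ℝ).normDet ^ 2) : ℝ) =
      (f.restrictScalars ℝ).normDet ^ 2 := rfl
    rw [h7] at h
    rw [h]
    erw [h5]
    simp [Complex.normSq_ofReal, sq]
  exact (sq_eq_sq₀ (LinearMap.normDet_nonneg _) (by positivity)).1 h6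

/-- The volume of a section is, up to the Jacobian factor, the volume of its projection along the
first coordinate. -/
theorem sectionVol_eq {n : ℕ} (a : EuclideanSpace ℂ (Fin (n + 1))) (ha : ‖a‖ = 1) (h0 : a 0 ≠ 0)
    (t : ℂ) :
    sectionVol a t = (‖a 0‖ ^ 2)⁻¹ * (volume {w : Fin n → ℂ | (∀ i, ‖w i‖ ≤ 1) ∧
      ‖t - ∑ i, starRingEnd ℂ (a i.succ) * w i‖ ≤ ‖a 0‖}).toReal := by
  have hn0 : (0 : ℝ) < ‖a 0‖ := norm_pos_iff.2 h0
  have hc : starRingEnd ℂ (a 0) ≠ 0 := by simpa using h0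
  let f : EuclideanSpace ℂ (Fin n) →ₗ[ℂ] EuclideanSpace ℂ (Fin (n + 1)) :=
    { toFun := fun w => WithLp.toLp 2 (Fin.cons
        (-(∑ i, starRingEnd ℂ (a i.succ) * w i) / starRingEnd ℂ (a 0)) fun i => w i)
      map_add' := fun x y => by
        ext i
        refine Fin.cases ?_ (fun i => ?_) i
        · simp [mul_add, Finset.sum_add_distrib]; ring
        · simp
      map_smul' := fun r x => by
        ext i
        refine Fin.cases ?_ (fun i => ?_) i
        · simp only [PiLp.smul_apply, smul_eq_mul, Fin.cons_zero, RingHom.id_apply,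
            mul_left_comm _ r, ← Finset.mul_sum]
          ring
        · simp }
  have hf0 : ∀ w, f w 0 = -(∑ i, starRingEnd ℂ (a i.succ) * w i) / starRingEnd ℂ (a 0) :=
    fun w => rfl
  have hfs : ∀ w i, f w (Fin.succ i) = w i := fun w i => rfl
  let p : EuclideanSpace ℂ (Fin (n + 1)) :=
    WithLp.toLp 2 (Fin.cons (t / starRingEnd ℂ (a 0)) fun _ => 0)
  let W : Set (EuclideanSpace ℂ (Fin n)) := {w | (∀ i, ‖w i‖ ≤ 1) ∧
      ‖t - ∑ i, starRingEnd ℂ (a i.succ) * w i‖ ≤ ‖a 0‖}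
  have himg : polydiscSection a t = (fun z => p + z) '' (f.restrictScalars ℝ '' W) := by
    have h00 : ∀ w, (p + f w) 0 =
        (t - ∑ i, starRingEnd ℂ (a i.succ) * w i) / starRingEnd ℂ (a 0) := fun w => by
      rw [PiLp.add_apply, hf0]
      simp only [p, Fin.cons_zero]
      ring
    have hss : ∀ w i, (p + f w) (Fin.succ i) = w i := fun w i => by
      rw [PiLp.add_apply, hfs]
      simp [p]
    have hnorm : ∀ w : EuclideanSpace ℂ (Fin n), ‖(p + f w) 0‖ ≤ 1 ↔
        ‖t - ∑ i, starRingEnd ℂ (a i.succ) * w i‖ ≤ ‖a 0‖ := fun w => by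
      rw [h00, norm_div, RCLike.norm_conj, div_le_one hn0]
    ext z
    simp only [polydiscSection, polydisc, Set.mem_ofPred_eq, Set.mem_image, exists_exists_and_eq_and]
    constructor
    · rintro ⟨hz, hzt⟩
      let w : EuclideanSpace ℂ (Fin n) := WithLp.toLp 2 fun i => z i.succ
      have hzw : p + f w = z := by
        ext i
        refine Fin.cases ?_ (fun i => ?_) i
        · rw [h00, div_eq_iff hc, ← hzt, PiLp.inner_apply, Fin.sum_univ_succ]
          simp [w, mul_comm]
        · rw [hss]
      refine ⟨w, ⟨fun i => hz i.succ, ?_⟩, hzw⟩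
      rw [← hnorm, hzw]
      exact hz 0
    · rintro ⟨w, ⟨hw, hwt⟩, rfl⟩
      refine ⟨fun i => ?_, ?_⟩
      · refine Fin.cases ?_ (fun i => ?_) i
        · exact (hnorm w).2 hwt
        · exact (hss w i).symm ▸ hw i
      · show inner ℂ a (p + f w) = t
        rw [PiLp.inner_apply, Fin.sum_univ_succ, h00]
        simp only [hss, RCLike.inner_apply]
        rw [div_mul_cancel₀ _ hc]
        simp [mul_comm]
  have hfr : 2 * (n + 1 - 1) = finrank ℝ (EuclideanSpace ℂ (Fin n)) := by
    rw [finrank_real_of_complex, finrank_euclideanSpace_fin, Nat.add_sub_cancel]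
  have hW : MeasurableSet W := by
    have h1 : IsClosed {w : EuclideanSpace ℂ (Fin n) | ∀ i, ‖w i‖ ≤ 1} := by
      simp only [Set.ofPred_forall]
      exact isClosed_iInter fun i => isClosed_le (by fun_prop) continuous_const
    have h2 : IsClosed {w : EuclideanSpace ℂ (Fin n) |
        ‖t - ∑ i, starRingEnd ℂ (a i.succ) * w i‖ ≤ ‖a 0‖} :=
      isClosed_le (by fun_prop) continuous_const
    exact (h1.inter h2).measurableSet
  rw [sectionVol, himg, (isometry_add_left p).euclideanHausdorffMeasure_image, hfr,
    LinearMap.euclideanHausdorffMeasure_image_eq_normDet_mul_volume,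
    normDet_graph a ha h0 f hf0 hfs, ENNReal.toReal_mul, ENNReal.toReal_ofReal (by positivity),
    ← (EuclideanSpace.volume_preserving_toLp_complex (Fin n)).measure_preimage hW.nullMeasurableSet]
  rfl

end Section

/-! ### The sections orthogonal to diagonal directions -/

section DiagonalSection

open MeasureTheory

theorem norm_diagVec {n k : ℕ} (hk : 1 ≤ k) (hkn : k ≤ n) : ‖diagVec n k‖ = 1 := by
  have hk0 : (0 : ℝ) < k := by exact_mod_cast hk
  have h : ‖diagVec n k‖ ^ 2 = 1 := by
    rw [EuclideanSpace.norm_sq_eq]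
    have e : ∀ i : Fin n, ‖diagVec n k i‖ ^ 2 = if (i : ℕ) < k then (1 / k : ℝ) else 0 := by
      intro i
      simp only [diagVec]
      split_ifs
      · rw [Complex.norm_real, Real.norm_of_nonneg (by positivity), div_pow,
          Real.sq_sqrt hk0.le, one_pow]
      · simp
    rw [Finset.sum_congr rfl fun i _ => e i, Fin.sum_univ_eq_sum_range
      (fun i => if i < k then (1 / k : ℝ) else 0) n, ← Finset.sum_filter]
    have hf : (Finset.range n).filter (· < k) = Finset.range k := by
      ext i; simp; omega
    rw [hf]
    simp [hk0.ne']
  have h0 := norm_nonneg (diagVec n k)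
  nlinarith

theorem norm_diagVec_zero {n k : ℕ} (hk : 1 ≤ k) : ‖diagVec (n + 1) k 0‖ = 1 / √k := by
  have h : ((0 : Fin (n + 1)) : ℕ) < k := hk
  simp only [diagVec, h, if_true]
  rw [Complex.norm_real, Real.norm_of_nonneg (by positivity)]

theorem sectionVol_diagVec_self (n : ℕ) (t : ℝ) :
    sectionVol (diagVec (n + 1) (n + 1)) (t : ℂ) =
      (n + 1) * (volume {w : Fin n → ℂ | (∀ i, ‖w i‖ ≤ 1) ∧
        ‖((√(n + 1) * t : ℝ) : ℂ) - ∑ i, w i‖ ≤ 1}).toReal := by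
  have hs : (0 : ℝ) < √((n : ℝ) + 1) := by positivity
  have h0 : ‖diagVec (n + 1) (n + 1) 0‖ = 1 / √((n : ℝ) + 1) := by
    rw [norm_diagVec_zero (by omega)]; push_cast; rfl
  have hne : diagVec (n + 1) (n + 1) 0 ≠ 0 := by
    rw [← norm_pos_iff, h0]; positivity
  rw [sectionVol_eq _ (norm_diagVec (by omega) le_rfl) hne, h0]
  congr 1
  · rw [div_pow, Real.sq_sqrt (by positivity)]; simp
  · congr 3
    ext w
    refine and_congr_right fun _ => ?_
    have e : (t : ℂ) - ∑ i : Fin n, starRingEnd ℂ (diagVec (n + 1) (n + 1) i.succ) * w i =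
        ((1 / √((n : ℝ) + 1) : ℝ) : ℂ) * (((√((n : ℝ) + 1) * t : ℝ) : ℂ) - ∑ i, w i) := by
      have hsc : ((√((n : ℝ) + 1) : ℝ) : ℂ) ≠ 0 := by exact_mod_cast hs.ne'
      rw [mul_sub, Finset.mul_sum]
      congr 1
      · push_cast; field_simp
      · refine Finset.sum_congr rfl fun i _ => ?_
        simp only [diagVec, Fin.is_lt, if_true, Complex.conj_ofReal]
        push_cast; rfl
    rw [e, norm_mul, Complex.norm_real, Real.norm_of_nonneg (by positivity),
      mul_le_iff_le_one_right (by positivity)]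

/-- After projection the constraint involves only `w 0`, which ranges over a lens; the other `n`
coordinates each contribute a full disc. -/
theorem sectionVol_diagVec_two (n : ℕ) (t : ℝ) :
    sectionVol (diagVec (n + 2) 2) (t : ℂ) =
      2 * (volume {z : ℂ | ‖z‖ ≤ 1 ∧ ‖((√2 * t : ℝ) : ℂ) - z‖ ≤ 1}).toReal * Real.pi ^ n := by
  have hs : (0 : ℝ) < √2 := by positivity
  have h0 : ‖diagVec (n + 2) 2 0‖ = 1 / √2 := by
    rw [norm_diagVec_zero (by omega)]; push_cast; rfl
  have hne : diagVec (n + 2) 2 0 ≠ 0 := by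
    rw [← norm_pos_iff, h0]; positivity
  rw [sectionVol_eq _ (norm_diagVec (by omega) (by omega)) hne, h0, mul_assoc]
  congr 1
  · rw [div_pow, Real.sq_sqrt (by positivity)]; simp
  · have hset : {w : Fin (n + 1) → ℂ | (∀ i, ‖w i‖ ≤ 1) ∧
        ‖(t : ℂ) - ∑ i, starRingEnd ℂ (diagVec (n + 2) 2 i.succ) * w i‖ ≤ 1 / √2} =
        Set.univ.pi (Fin.cons {z : ℂ | ‖z‖ ≤ 1 ∧ ‖((√2 * t : ℝ) : ℂ) - z‖ ≤ 1}
          fun _ : Fin n => Metric.closedBall (0 : ℂ) 1) := by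
      ext w
      have e : (t : ℂ) - ∑ i : Fin (n + 1), starRingEnd ℂ (diagVec (n + 2) 2 i.succ) * w i =
          ((1 / √2 : ℝ) : ℂ) * (((√2 * t : ℝ) : ℂ) - w 0) := by
        have hsc : ((√2 : ℝ) : ℂ) ≠ 0 := by exact_mod_cast hs.ne'
        rw [Fin.sum_univ_succ, Finset.sum_eq_zero]
        · simp [diagVec]
          field_simp
        · intro i _
          have : ¬ ((i.succ.succ : Fin (n + 2)) : ℕ) < 2 := by simp
          simp only [diagVec, this, if_false]
          simp
      simp only [Set.mem_ofPred_eq, Set.mem_pi, Set.mem_univ, true_imp_iff]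
      rw [e, norm_mul, Complex.norm_real, Real.norm_of_nonneg (by positivity),
        mul_le_iff_le_one_right (by positivity), Fin.forall_fin_succ, Fin.forall_fin_succ]
      simp only [Fin.cons_zero, Fin.cons_succ, Set.mem_ofPred_eq, mem_closedBall_zero_iff]
      tauto
    rw [hset, volume_pi_pi, Fin.prod_univ_succ]
    simp only [Fin.cons_zero, Fin.cons_succ, Finset.prod_const, Complex.volume_closedBall,
      ENNReal.toReal_mul, ENNReal.toReal_pow]
    simp

theorem volume_setOf_sq_le (g : ℝ) : volume {b : ℝ | b ^ 2 ≤ g} = ENNReal.ofReal (2 * √g) := by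
  rcases lt_or_ge g 0 with h | h
  · have : {b : ℝ | b ^ 2 ≤ g} = ∅ := by
      ext b
      simp only [Set.mem_ofPred_eq, Set.mem_empty_iff_false, iff_false, not_le]
      exact h.trans_le (sq_nonneg b)
    rw [this, Real.sqrt_eq_zero_of_nonpos h.le]
    simp
  · have : {b : ℝ | b ^ 2 ≤ g} = Set.Icc (-√g) (√g) := by
      ext b
      simp only [Set.mem_ofPred_eq, Set.mem_Icc]
      rw [Real.sq_le h]
    rw [this, Real.volume_Icc]
    congr 1
    ring

/-- The area of a lens. -/
theorem volume_lens {u : ℝ} (hu0 : 0 ≤ u) (hu : u ≤ 1) :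
    (volume {z : ℂ | ‖z‖ ≤ 1 ∧ ‖((2 * u : ℝ) : ℂ) - z‖ ≤ 1}).toReal =
      4 * ∫ s in u..1, √(1 - s ^ 2) := by
  set g : ℝ → ℝ := fun a => min (1 - a ^ 2) (1 - (2 * u - a) ^ 2) with hg
  have hgc : Continuous g := by fun_prop
  have hpre : {z : ℂ | ‖z‖ ≤ 1 ∧ ‖((2 * u : ℝ) : ℂ) - z‖ ≤ 1} =
      Complex.measurableEquivRealProd ⁻¹' {p : ℝ × ℝ | p.2 ^ 2 ≤ g p.1} := by
    ext z
    have h1 : ∀ w : ℂ, ‖w‖ ≤ 1 ↔ w.re ^ 2 + w.im ^ 2 ≤ 1 := fun w => by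
      rw [← sq_le_one_iff₀ (norm_nonneg w), ← Complex.normSq_eq_norm_sq, Complex.normSq_apply]
      simp only [sq]
    simp only [Set.mem_ofPred_eq, Set.mem_preimage, h1, hg, Complex.measurableEquivRealProd_apply,
      le_min_iff, Complex.sub_re, Complex.sub_im, Complex.ofReal_re, Complex.ofReal_im]
    constructor
    · rintro ⟨h1, h2⟩; constructor <;> linarith
    · rintro ⟨h1, h2⟩; constructor <;> linarith
  have hmeas : MeasurableSet {p : ℝ × ℝ | p.2 ^ 2 ≤ g p.1} :=
    (isClosed_le (by fun_prop) (hgc.comp continuous_fst)).measurableSet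
  have hsupp : ∀ a, a ∉ Set.Ioc (2 * u - 1) 1 → 2 * √(g a) = 0 := fun a ha => by
    rw [Real.sqrt_eq_zero_of_nonpos, mul_zero]
    rw [Set.mem_Ioc, not_and_or, not_lt, not_le] at ha
    rcases ha with h | h
    · exact (min_le_right _ _).trans (by nlinarith)
    · exact (min_le_left _ _).trans (by nlinarith)
  have hcont : Continuous fun a => 2 * √(g a) := by fun_prop
  have hle : 2 * u - 1 ≤ 1 := by linarith
  have hint : Integrable fun a => 2 * √(g a) := by
    rw [← integrableOn_iff_integrable_of_support_subset
      (s := Set.Ioc (2 * u - 1) 1) fun a ha => by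
        by_contra h
        exact ha (hsupp a h)]
    exact (hcont.integrableOn_Icc).mono_set Set.Ioc_subset_Icc_self
  rw [hpre, Complex.volume_preserving_equiv_real_prod.measure_preimage hmeas.nullMeasurableSet,
    Measure.volume_eq_prod, Measure.prod_apply hmeas]
  have hsec : ∀ a : ℝ, volume (Prod.mk a ⁻¹' {p : ℝ × ℝ | p.2 ^ 2 ≤ g p.1}) =
      ENNReal.ofReal (2 * √(g a)) := fun a => volume_setOf_sq_le (g a)
  simp only [hsec]
  rw [← ofReal_integral_eq_lintegral_ofReal hint (Eventually.of_forall fun a => by positivity),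
    ENNReal.toReal_ofReal (integral_nonneg fun a => by positivity),
    ← setIntegral_eq_integral_of_forall_compl_eq_zero hsupp,
    ← intervalIntegral.integral_of_le hle,
    ← intervalIntegral.integral_add_adjacent_intervals (b := u)
      (hcont.intervalIntegrable _ _) (hcont.intervalIntegrable _ _)]
  -- The lens is symmetric about the line of real part `u`: to its right the unit disc at `0` is the
  -- binding constraint, to its left the disc centred at `2u`.
  have h2 : ∫ a in u..1, 2 * √(g a) = 2 * ∫ s in u..1, √(1 - s ^ 2) := by
    rw [← intervalIntegral.integral_const_mul]
    refine intervalIntegral.integral_congr fun a ha => ?_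
    rw [Set.uIcc_of_le hu] at ha
    simp only [hg]
    rw [min_eq_left (by nlinarith [ha.1])]
  have h1 : ∫ a in (2 * u - 1)..u, 2 * √(g a) = 2 * ∫ s in u..1, √(1 - s ^ 2) := by
    have h3 : ∫ a in (2 * u - 1)..u, 2 * √(g a) =
        ∫ a in (2 * u - 1)..u, 2 * √(1 - (2 * u - a) ^ 2) := by
      refine intervalIntegral.integral_congr fun a ha => ?_
      rw [Set.uIcc_of_le (by linarith)] at ha
      simp only [hg]
      rw [min_eq_right (by nlinarith [ha.2])]
    rw [h3, intervalIntegral.integral_comp_sub_left (fun s => 2 * √(1 - s ^ 2)),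
      intervalIntegral.integral_const_mul]
    congr 2 <;> ring
  rw [h1, h2]
  ring

theorem integral_sqrt_one_sub_sq_zero_one : ∫ s in (0 : ℝ)..1, √(1 - s ^ 2) = Real.pi / 4 := by
  have h := volume_lens le_rfl zero_le_one
  have e : {z : ℂ | ‖z‖ ≤ 1 ∧ ‖((2 * 0 : ℝ) : ℂ) - z‖ ≤ 1} = Metric.closedBall 0 1 := by
    ext z; simp
  rw [e, Complex.volume_closedBall] at h
  simp at h
  linarith

theorem sectionVol_diagVec_two_eq (n : ℕ) {t : ℝ} (ht0 : 0 ≤ t) (ht : t ≤ 1) :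
    sectionVol (diagVec (n + 2) 2) (t : ℂ) =
      Real.pi ^ (n + 1) * (2 - 8 / Real.pi * ∫ s in (0 : ℝ)..(t / √2), √(1 - s ^ 2)) := by
  have hs : (0 : ℝ) < √2 := by positivity
  have hs2 : √2 * √2 = 2 := Real.mul_self_sqrt (by norm_num)
  have hs1 : 1 ≤ √2 := by rw [Real.one_le_sqrt]; norm_num
  have hu : √2 * t = 2 * (t / √2) := by
    field_simp
    rw [sq, hs2]
    ring
  have hc : Continuous fun s : ℝ => √(1 - s ^ 2) := by fun_prop
  have hadd := intervalIntegral.integral_add_adjacent_intervals (a := 0) (b := t / √2) (c := 1)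
    (hc.intervalIntegrable (μ := volume) _ _) (hc.intervalIntegrable _ _)
  rw [integral_sqrt_one_sub_sq_zero_one] at hadd
  rw [sectionVol_diagVec_two, hu, volume_lens (by positivity)
    (by rw [div_le_one hs]; linarith), ← sub_eq_iff_eq_add'.2 hadd.symm, pow_succ]
  have := Real.pi_pos
  field_simp
  ring

end DiagonalSection

/-! ### Fourier transforms of radial functions on the plane -/

section RadialFourier

open MeasureTheory

theorem integral_cos_pow_even_circle (m : ℕ) :
    ∫ θ in (-Real.pi)..Real.pi, Real.cos θ ^ (2 * m) =
      2 * Real.pi * ((2 * m).factorial / (4 ^ m * m.factorial ^ 2)) := by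
  induction m with
  | zero => simp; ring
  | succ m ih =>
    rw [show 2 * (m + 1) = 2 * m + 2 by ring, integral_cos_pow, ih, Nat.factorial_succ,
      Nat.factorial_succ, Nat.factorial_succ]
    have := Nat.factorial_ne_zero m
    simp
    field_simp
    ring

theorem hasSum_cos_mul_cos_integral (z : ℝ) :
    HasSum (fun m : ℕ => ∫ θ in (-Real.pi)..Real.pi,
      (-1 : ℝ) ^ m * (z * Real.cos θ) ^ (2 * m) / (2 * m).factorial)
      (∫ θ in (-Real.pi)..Real.pi, Real.cos (z * Real.cos θ)) := by
  refine intervalIntegral.hasSum_integral_of_dominated_convergence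
    (fun m _ => |z| ^ (2 * m) / (2 * m).factorial) (fun m => ?_) (fun m => ?_) ?_ ?_ ?_
  · exact (by fun_prop : Continuous fun θ : ℝ => (-1 : ℝ) ^ m * (z * Real.cos θ) ^ (2 * m) /
      (2 * m).factorial).aestronglyMeasurable
  · refine Eventually.of_forall fun θ _ => ?_
    rw [norm_div, norm_mul, norm_pow, norm_pow, norm_neg, norm_one, one_pow, one_mul, norm_mul]
    simp only [Real.norm_eq_abs, Nat.abs_cast]
    gcongr
    exact mul_le_of_le_one_right (abs_nonneg z) (Real.abs_cos_le_one θ)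
  · refine Eventually.of_forall fun θ _ => ?_
    exact (Real.summable_pow_div_factorial |z|).comp_injective
      (mul_right_injective₀ (two_ne_zero))
  · exact intervalIntegrable_const
  · exact Eventually.of_forall fun θ _ => Real.hasSum_cos (z * Real.cos θ)

/-- Bessel's integral for `J_0(z)`: integrate the cosine series termwise with Wallis' formula. -/
theorem integral_cos_mul_cos (z : ℝ) :
    ∫ θ in (-Real.pi)..Real.pi, Real.cos (z * Real.cos θ) =
      2 * Real.pi * besselClifford 0 (z ^ 2 / 4) := by
  refine (hasSum_cos_mul_cos_integral z).unique ?_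
  convert! (hasSum_besselClifford 0 (z ^ 2 / 4)).mul_left (2 * Real.pi) using 2 with m
  have e : ∀ θ : ℝ, (-1 : ℝ) ^ m * (z * Real.cos θ) ^ (2 * m) / (2 * m).factorial =
      (-1 : ℝ) ^ m * z ^ (2 * m) / (2 * m).factorial * Real.cos θ ^ (2 * m) := fun θ => by
    rw [mul_pow]; ring
  simp_rw [e]
  rw [intervalIntegral.integral_const_mul, integral_cos_pow_even_circle, neg_pow (z ^ 2 / 4),
    div_pow, ← pow_mul]
  have := Nat.factorial_ne_zero m
  have := Nat.factorial_ne_zero (2 * m)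
  simp
  field_simp

theorem integral_sin_mul_cos (z : ℝ) :
    ∫ θ in (-Real.pi)..Real.pi, Real.sin (z * Real.cos θ) = 0 := by
  have hp : Function.Periodic (fun θ => Real.sin (z * Real.cos θ)) (2 * Real.pi) := fun θ => by
    simp
  have h := hp.intervalIntegral_add_eq (-Real.pi) 0
  have h2 : ∫ θ in (-Real.pi)..Real.pi, Real.sin (z * Real.cos (θ + Real.pi)) =
      ∫ θ in (0 : ℝ)..(0 + 2 * Real.pi), Real.sin (z * Real.cos θ) := by
    rw [intervalIntegral.integral_comp_add_right (fun θ => Real.sin (z * Real.cos θ))]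
    congr 1 <;> ring
  rw [show -Real.pi + 2 * Real.pi = Real.pi by ring] at h
  simp only [Real.cos_add_pi, mul_neg, Real.sin_neg, intervalIntegral.integral_neg] at h2
  linarith

/-- A rotation reduces the phase to `z cos θ`, where `z` is the length of `(a, b)`; the imaginary
part then vanishes under `θ ↦ θ + π`. -/
theorem integral_exp_circle (a b : ℝ) :
    ∫ θ in (-Real.pi)..Real.pi,
      Complex.exp ((a * Real.cos θ + b * Real.sin θ : ℝ) * Complex.I) =
      (2 * Real.pi * besselClifford 0 ((a ^ 2 + b ^ 2) / 4) : ℝ) := by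
  set ξ : ℂ := ⟨a, b⟩ with hξ
  set z : ℝ := ‖ξ‖
  set α : ℝ := Complex.arg ξ
  have ha : a = z * Real.cos α := (Complex.norm_mul_cos_arg ξ).symm
  have hb : b = z * Real.sin α := (Complex.norm_mul_sin_arg ξ).symm
  have hz : a ^ 2 + b ^ 2 = z ^ 2 := by
    rw [Complex.sq_norm, Complex.normSq_apply]; simp [hξ]; ring
  have e : ∀ θ, a * Real.cos θ + b * Real.sin θ = z * Real.cos (θ - α) := fun θ => by
    rw [Real.cos_sub, ha, hb]; ring
  simp_rw [e]
  have hp : Function.Periodic (fun θ => Complex.exp ((z * Real.cos θ : ℝ) * Complex.I))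
      (2 * Real.pi) := fun θ => by simp
  have h := hp.intervalIntegral_add_eq (-Real.pi) (-Real.pi - α)
  rw [show -Real.pi + 2 * Real.pi = Real.pi by ring,
    show -Real.pi - α + 2 * Real.pi = Real.pi - α by ring] at h
  rw [intervalIntegral.integral_comp_sub_right
    (fun θ => Complex.exp ((z * Real.cos θ : ℝ) * Complex.I)), ← h]
  have e2 : ∀ θ : ℝ, Complex.exp ((z * Real.cos θ : ℝ) * Complex.I) =
      ((Real.cos (z * Real.cos θ) : ℝ) : ℂ) + ((Real.sin (z * Real.cos θ) : ℝ) : ℂ) * Complex.I :=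
    fun θ => by rw [Complex.exp_mul_I, ← Complex.ofReal_cos, ← Complex.ofReal_sin]
  simp_rw [e2]
  rw [intervalIntegral.integral_add
    ((by fun_prop : Continuous _).intervalIntegrable _ _)
    ((by fun_prop : Continuous _).intervalIntegrable _ _),
    intervalIntegral.integral_mul_const, intervalIntegral.integral_ofReal,
    intervalIntegral.integral_ofReal, integral_cos_mul_cos, integral_sin_mul_cos, hz]
  simp

theorem integral_radial_mul_exp {φ : ℝ → ℝ}
    (hφ : IntegrableOn (fun ρ => ρ * φ ρ) (Set.Ioi 0)) (s : ℝ) (ξ : ℂ) :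
    ∫ w : ℂ, Complex.exp ((s * inner ℝ w ξ : ℝ) * Complex.I) * (φ ‖w‖ : ℂ) =
      (2 * Real.pi * ∫ ρ in Set.Ioi (0 : ℝ),
        ρ * φ ρ * besselClifford 0 (s ^ 2 * ‖ξ‖ ^ 2 / 4 * ρ ^ 2) : ℝ) := by
  rw [← Complex.integral_comp_polarCoord_symm, show polarCoord.target =
    Set.Ioi (0 : ℝ) ×ˢ Set.Ioo (-Real.pi) Real.pi from rfl]
  have e : ∀ p ∈ Set.Ioi (0 : ℝ) ×ˢ Set.Ioo (-Real.pi) Real.pi,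
      p.1 • (Complex.exp ((s * inner ℝ (Complex.polarCoord.symm p) ξ : ℝ) * Complex.I) *
        (φ ‖Complex.polarCoord.symm p‖ : ℂ)) =
      ((p.1 * φ p.1 : ℝ) : ℂ) * Complex.exp ((s * p.1 * ξ.re * Real.cos p.2 +
        s * p.1 * ξ.im * Real.sin p.2 : ℝ) * Complex.I) := by
    intro p hp
    have h1 : ‖Complex.polarCoord.symm p‖ = p.1 := by
      rw [Complex.norm_polarCoord_symm, abs_of_pos hp.1]
    have h2 : inner ℝ (Complex.polarCoord.symm p) ξ =
        p.1 * ξ.re * Real.cos p.2 + p.1 * ξ.im * Real.sin p.2 := by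
      rw [Complex.polarCoord_symm_apply, Complex.inner]
      simp only [map_mul, map_add, Complex.conj_ofReal, Complex.conj_I, Complex.mul_re,
        Complex.mul_im, Complex.add_re, Complex.add_im, Complex.ofReal_re, Complex.ofReal_im,
        Complex.neg_re, Complex.neg_im, Complex.I_re, Complex.I_im]
      ring
    rw [h1, h2, Complex.real_smul]
    push_cast
    ring_nf
  rw [setIntegral_congr_fun (measurableSet_Ioi.prod measurableSet_Ioo) e,
    Measure.volume_eq_prod, setIntegral_prod]
  · rw [← integral_const_mul, ← integral_complex_ofReal]
    refine setIntegral_congr_fun measurableSet_Ioi fun ρ _ => ?_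
    simp only
    rw [integral_const_mul, ← integral_Ioc_eq_integral_Ioo,
      ← intervalIntegral.integral_of_le (by linarith [Real.pi_pos]), integral_exp_circle]
    have : (s * ρ * ξ.re) ^ 2 + (s * ρ * ξ.im) ^ 2 = s ^ 2 * ‖ξ‖ ^ 2 * ρ ^ 2 := by
      rw [Complex.sq_norm, Complex.normSq_apply]; ring
    rw [this, show s ^ 2 * ‖ξ‖ ^ 2 * ρ ^ 2 / 4 = s ^ 2 * ‖ξ‖ ^ 2 / 4 * ρ ^ 2 by ring]
    push_cast
    ring
  · rw [IntegrableOn, ← Measure.prod_restrict]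
    have h1 : Integrable (fun ρ => ((ρ * φ ρ : ℝ) : ℂ)) (volume.restrict (Set.Ioi (0 : ℝ))) :=
      hφ.ofReal
    have h2 : Integrable (fun _ : ℝ => (1 : ℂ))
        (volume.restrict (Set.Ioo (-Real.pi) Real.pi)) := integrable_const _
    refine ((h1.mul_prod h2).bdd_mul (c := 1) (f := fun p : ℝ × ℝ =>
      Complex.exp ((s * p.1 * ξ.re * Real.cos p.2 +
        s * p.1 * ξ.im * Real.sin p.2 : ℝ) * Complex.I))
      (by fun_prop : Continuous _).aestronglyMeasurable
      (Eventually.of_forall fun p => (Complex.norm_exp_ofReal_mul_I _).le)).congr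
      (Eventually.of_forall fun p => ?_)
    simp only
    ring

theorem integral_closedBall_exp (s : ℝ) (ξ : ℂ) :
    ∫ w in Metric.closedBall (0 : ℂ) 1, Complex.exp ((s * inner ℝ w ξ : ℝ) * Complex.I) =
      (Real.pi * besselClifford 1 (s ^ 2 * ‖ξ‖ ^ 2 / 4) : ℝ) := by
  set Y := s ^ 2 * ‖ξ‖ ^ 2 / 4 with hY
  set φ : ℝ → ℝ := (Set.Iic (1 : ℝ)).indicator 1 with hφ
  have hφm : (fun ρ => ρ * φ ρ) = (Set.Iic (1 : ℝ)).indicator fun ρ => ρ := by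
    ext ρ; by_cases h : ρ ≤ 1 <;> simp [hφ, h]
  have hint : IntegrableOn (fun ρ => ρ * φ ρ) (Set.Ioi 0) := by
    rw [hφm, IntegrableOn, integrable_indicator_iff measurableSet_Iic, IntegrableOn,
      Measure.restrict_restrict measurableSet_Iic, Set.inter_comm, Set.Ioi_inter_Iic]
    exact (continuous_id.integrableOn_Icc).mono_set Set.Ioc_subset_Icc_self
  have h := integral_radial_mul_exp hint s ξ
  have e1 : ∫ w : ℂ, Complex.exp ((s * inner ℝ w ξ : ℝ) * Complex.I) * (φ ‖w‖ : ℂ) =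
      ∫ w in Metric.closedBall (0 : ℂ) 1, Complex.exp ((s * inner ℝ w ξ : ℝ) * Complex.I) := by
    rw [← integral_indicator measurableSet_closedBall]
    congr 1 with w
    by_cases hw : ‖w‖ ≤ 1 <;> simp [hφ, Set.indicator, hw]
  have e2 : ∫ ρ in Set.Ioi (0 : ℝ), ρ * φ ρ * besselClifford 0 (Y * ρ ^ 2) =
      ∫ ρ in (0 : ℝ)..1, ρ * besselClifford 0 (Y * ρ ^ 2) := by
    rw [intervalIntegral.integral_of_le zero_le_one, ← Set.Ioi_inter_Iic, Set.inter_comm,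
      ← Measure.restrict_restrict measurableSet_Iic, ← integral_indicator measurableSet_Iic]
    congr 1 with ρ
    by_cases h : ρ ≤ 1 <;> simp [hφ, Set.indicator, h]
  -- The antiderivative `ρ²/2 · B_1(Y ρ²)` is the contiguity relation `B_0 = B_1 - y B_2`.
  have e3 : ∫ ρ in (0 : ℝ)..1, ρ * besselClifford 0 (Y * ρ ^ 2) = besselClifford 1 Y / 2 := by
    have hd : ∀ ρ ∈ Set.uIcc (0 : ℝ) 1, HasDerivAt
        (fun ρ => ρ ^ 2 / 2 * besselClifford 1 (Y * ρ ^ 2))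
        (ρ * besselClifford 0 (Y * ρ ^ 2)) ρ := fun ρ _ => by
      have h1 := (hasDerivAt_besselClifford 1 (Y * ρ ^ 2)).comp ρ
        ((hasDerivAt_pow 2 ρ).const_mul Y)
      convert! ((hasDerivAt_pow 2 ρ).div_const 2).mul h1 using 1
      rw [besselClifford_contiguous 0]
      simp
      ring
    have hc0 := continuous_besselClifford 0
    rw [intervalIntegral.integral_eq_sub_of_hasDerivAt hd
      ((by fun_prop : Continuous _).intervalIntegrable _ _)]
    simp
    ring
  rw [← e1, h, e2, e3]
  congr 1
  ring

end RadialFourier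

/-! ### Sums of independent uniform points of the disc -/

section DiscSum

open MeasureTheory FourierTransform

variable {n : ℕ}

theorem mul_besselClifford_one_sq_le {y : ℝ} (hy : 0 ≤ y) : y * besselClifford 1 y ^ 2 ≤ 1 := by
  have h := antitoneOn_energy_besselClifford 0 (Set.mem_Ici.2 le_rfl) (Set.mem_Ici.2 hy) hy
  simp at h
  nlinarith [sq_nonneg (besselClifford 0 y)]

/-- The energy gives `|B_1(π²ρ²)|` of order at most `1/ρ`, so four factors give a decay integrable
on the plane, as Fourier inversion requires. -/
theorem abs_besselClifford_one_pow_le_inv {m : ℕ} (hm : 4 ≤ m) (ρ : ℝ) :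
    |besselClifford 1 (Real.pi ^ 2 * ρ ^ 2)| ^ m ≤ 4 * ((1 + ρ ^ 2) ^ 2)⁻¹ := by
  set y := Real.pi ^ 2 * ρ ^ 2 with hy
  have hy0 : 0 ≤ y := by positivity
  have h1 := abs_besselClifford_one_le_one hy0
  have h2 := mul_besselClifford_one_sq_le hy0
  have h3 : (1 + ρ ^ 2) * besselClifford 1 y ^ 2 ≤ 2 := by
    have h4 : ρ ^ 2 ≤ y := by
      have : 1 ≤ Real.pi ^ 2 := by nlinarith [Real.pi_gt_three]
      rw [hy]; nlinarith [sq_nonneg ρ]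
    have h5 : besselClifford 1 y ^ 2 ≤ 1 := by rw [sq_le_one_iff_abs_le_one]; exact h1
    nlinarith [sq_nonneg (besselClifford 1 y)]
  calc _ ≤ |besselClifford 1 y| ^ 4 := pow_le_pow_of_le_one (abs_nonneg _) h1 hm
    _ = (besselClifford 1 y ^ 2) ^ 2 := by
      rw [← pow_mul]
      exact (show Even (2 * 2) by decide).pow_abs _
    _ ≤ (2 / (1 + ρ ^ 2)) ^ 2 := by
      gcongr
      rw [le_div_iff₀ (by positivity)]
      linarith
    _ = _ := by rw [div_pow]; ring

/-- The indicator function of the closed unit disc. -/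
noncomputable def discIndicator : ℂ → ℂ := (Metric.closedBall (0 : ℂ) 1).indicator 1

theorem measurable_discIndicator : Measurable discIndicator :=
  measurable_one.indicator measurableSet_closedBall

theorem norm_discIndicator_le (z : ℂ) : ‖discIndicator z‖ ≤ 1 := by
  by_cases h : ‖z‖ ≤ 1 <;> simp [discIndicator, Set.indicator, h]

theorem integrable_discIndicator : Integrable discIndicator := by
  rw [discIndicator, integrable_indicator_iff measurableSet_closedBall]
  exact integrableOn_const (isCompact_closedBall _ _).measure_ne_top

/-- Lebesgue measure on the product of `n` unit discs. -/
noncomputable def polydiscMeasure (n : ℕ) : Measure (Fin n → ℂ) :=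
  Measure.pi fun _ => volume.restrict (Metric.closedBall (0 : ℂ) 1)

theorem polydiscMeasure_eq_restrict (n : ℕ) : polydiscMeasure n =
    volume.restrict (Set.univ.pi fun _ : Fin n => Metric.closedBall (0 : ℂ) 1) :=
  (Measure.restrict_pi_pi (fun _ => volume) _).symm

instance (n : ℕ) : IsFiniteMeasure (polydiscMeasure n) :=
  ⟨by rw [polydiscMeasure_eq_restrict, Measure.restrict_apply_univ]
      exact (isCompact_univ_pi fun _ => isCompact_closedBall _ _).measure_lt_top⟩

/-- The volume of the set of points of `𝔻ⁿ` whose coordinates sum to a point at distance at most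
one of `c`. -/
noncomputable def discSumDensity (n : ℕ) (c : ℂ) : ℂ :=
  ∫ w, discIndicator (c - ∑ i, w i) ∂polydiscMeasure n

theorem discSumDensity_eq (n : ℕ) (c : ℂ) : discSumDensity n c =
    (volume {w : Fin n → ℂ | (∀ i, ‖w i‖ ≤ 1) ∧ ‖c - ∑ i, w i‖ ≤ 1}).toReal := by
  have hm : MeasurableSet {w : Fin n → ℂ | ‖c - ∑ i, w i‖ ≤ 1} :=
    (isClosed_le (by fun_prop) continuous_const).measurableSet
  have e : (fun w : Fin n → ℂ => discIndicator (c - ∑ i, w i)) =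
      {w : Fin n → ℂ | ‖c - ∑ i, w i‖ ≤ 1}.indicator 1 := by
    ext w
    by_cases h : ‖c - ∑ i, w i‖ ≤ 1 <;> simp [discIndicator, Set.indicator, h]
  rw [discSumDensity, e, integral_indicator hm]
  simp only [Pi.one_apply, integral_const, Complex.real_smul, mul_one]
  rw [polydiscMeasure_eq_restrict, Measure.real, Measure.restrict_apply_univ,
    Measure.restrict_apply hm]
  congr 3
  ext w
  simp [and_comm]

/-- Inversion at every point needs continuity. The integrand jumps in `c` only when `∑ w i` lies on
a circle, a null condition because the sum is a surjective linear map; dominated convergence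
concludes. -/
theorem continuous_discSumDensity (hn : 1 ≤ n) : Continuous (discSumDensity n) := by
  rw [continuous_iff_continuousAt]
  intro c
  refine continuousAt_of_dominated (bound := fun _ => 1) (Eventually.of_forall fun x => ?_)
    (Eventually.of_forall fun x => Eventually.of_forall fun w => norm_discIndicator_le _)
    (integrable_const _) ?_
  · exact (measurable_discIndicator.comp (by fun_prop)).aestronglyMeasurable
  · set L : (Fin n → ℂ) →ₗ[ℝ] ℂ := ∑ i, LinearMap.proj i with hL
    have hLa : ∀ w, L w = ∑ i, w i := fun w => by simp [hL]
    have hs : Function.Surjective L := fun z =>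
      ⟨Pi.single ⟨0, hn⟩ z, by rw [hLa]; simp⟩
    have h0 : ∀ᵐ y : ℂ, y ∈ (Metric.sphere c 1)ᶜ :=
      compl_mem_ae_iff.2 (Measure.addHaar_sphere volume c 1)
    have h1 := (ae_comp_linearMap_mem_iff (L := L) volume volume hs
      Metric.isClosed_sphere.measurableSet.compl).2 h0
    rw [polydiscMeasure_eq_restrict]
    filter_upwards [ae_restrict_of_ae h1] with w hw
    rw [hLa] at hw
    have hne : c - ∑ i, w i ∉ frontier (Metric.closedBall (0 : ℂ) 1) := by
      rw [frontier_closedBall _ one_ne_zero]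
      intro h
      apply hw
      rw [mem_sphere_zero_iff_norm, norm_sub_rev] at h
      simpa [dist_eq_norm] using h
    exact ContinuousAt.comp (f := fun x => x - ∑ i, w i)
      (((continuous_const (y := (1 : ℂ))).continuousOn.continuousAt_indicator hne)) (by fun_prop)

theorem measurable_discIndicator_sub (n : ℕ) :
    Measurable fun p : ℂ × (Fin n → ℂ) => discIndicator (p.1 - ∑ i, p.2 i) :=
  measurable_discIndicator.comp (by fun_prop)

theorem integral_norm_discIndicator_sub (z : ℂ) :
    ∫ c, ‖discIndicator (c - z)‖ = ∫ c, ‖discIndicator c‖ :=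
  integral_sub_right_eq_self (fun c => ‖discIndicator c‖) z

theorem integrable_discIndicator_sub_const (z : ℂ) :
    Integrable fun c => discIndicator (c - z) :=
  integrable_discIndicator.comp_sub_right z

theorem integrable_discIndicator_sub (n : ℕ) :
    Integrable (fun p : ℂ × (Fin n → ℂ) => discIndicator (p.1 - ∑ i, p.2 i))
      (volume.prod (polydiscMeasure n)) := by
  rw [integrable_prod_iff' (measurable_discIndicator_sub n).aestronglyMeasurable]
  refine ⟨Eventually.of_forall fun w => integrable_discIndicator_sub_const (∑ i, w i), ?_⟩
  simp only [integral_norm_discIndicator_sub]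
  exact integrable_const _

theorem integrable_discSumDensity (n : ℕ) : Integrable (discSumDensity n) :=
  (integrable_discIndicator_sub n).integral_prod_left

theorem integral_discIndicator_exp (s : ℝ) (ξ : ℂ) :
    ∫ w : ℂ, Complex.exp ((s * inner ℝ w ξ : ℝ) * Complex.I) * discIndicator w =
      (Real.pi * besselClifford 1 (s ^ 2 * ‖ξ‖ ^ 2 / 4) : ℝ) := by
  rw [← integral_closedBall_exp, ← integral_indicator measurableSet_closedBall]
  congr 1 with w
  by_cases h : ‖w‖ ≤ 1 <;> simp [discIndicator, Set.indicator, h]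

theorem integral_polydiscMeasure_exp (n : ℕ) (s : ℝ) (ξ : ℂ) :
    ∫ w, Complex.exp ((s * inner ℝ (∑ i, w i) ξ : ℝ) * Complex.I) ∂polydiscMeasure n =
      ((Real.pi * besselClifford 1 (s ^ 2 * ‖ξ‖ ^ 2 / 4)) ^ n : ℝ) := by
  have e : ∀ w : Fin n → ℂ, Complex.exp ((s * inner ℝ (∑ i, w i) ξ : ℝ) * Complex.I) =
      ∏ i, Complex.exp ((s * inner ℝ (w i) ξ : ℝ) * Complex.I) := fun w => by
    rw [← Complex.exp_sum, sum_inner, Finset.mul_sum]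
    push_cast
    rw [Finset.sum_mul]
  simp_rw [e]
  rw [polydiscMeasure, integral_fintype_prod_eq_pow
    (fun z => Complex.exp ((s * inner ℝ z ξ : ℝ) * Complex.I)), integral_closedBall_exp]
  simp

/-- The density is the convolution of `n + 1` disc indicators: `n` from the measure and one from the
integrand. -/
theorem fourier_discSumDensity (n : ℕ) (ξ : ℂ) :
    𝓕 (discSumDensity n) ξ =
      ((Real.pi * besselClifford 1 (Real.pi ^ 2 * ‖ξ‖ ^ 2)) ^ (n + 1) : ℝ) := by
  obtain ⟨E, hE⟩ : ∃ E : ℂ → ℂ, ∀ z,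
      E z = Complex.exp ((-2 * Real.pi * inner ℝ z ξ : ℝ) * Complex.I) := ⟨_, fun _ => rfl⟩
  have hEc : Continuous E := by
    rw [funext hE]
    fun_prop
  have hEn : ∀ z, ‖E z‖ ≤ 1 := fun z => by
    rw [hE]
    exact (Complex.norm_exp_ofReal_mul_I _).le
  have hEadd : ∀ z w, E (z + w) = E z * E w := fun z w => by
    rw [hE, hE, hE, ← Complex.exp_add, inner_add_left, mul_add, Complex.ofReal_add, add_mul]
  have hint : Integrable (Function.uncurry fun (c : ℂ) (w : Fin n → ℂ) =>
      E c * discIndicator (c - ∑ i, w i)) (volume.prod (polydiscMeasure n)) :=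
    (integrable_discIndicator_sub n).bdd_mul (c := 1) (f := fun p : ℂ × (Fin n → ℂ) => E p.1)
      (hEc.comp continuous_fst).aestronglyMeasurable (Eventually.of_forall fun p => hEn _)
  have hY : (-2 * Real.pi) ^ 2 * ‖ξ‖ ^ 2 / 4 = Real.pi ^ 2 * ‖ξ‖ ^ 2 := by ring
  have h1 : ∀ w : Fin n → ℂ, ∫ c, E c * discIndicator (c - ∑ i, w i) =
      E (∑ i, w i) * (Real.pi * besselClifford 1 (Real.pi ^ 2 * ‖ξ‖ ^ 2) : ℝ) := fun w => by
    rw [← integral_add_right_eq_self _ (∑ i, w i)]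
    have h2 := integral_discIndicator_exp (-2 * Real.pi) ξ
    simp only [← hE] at h2
    rw [hY] at h2
    rw [← h2, ← integral_const_mul]
    refine integral_congr_ae (Eventually.of_forall fun c => ?_)
    simp only [add_sub_cancel_right, hEadd]
    ring
  have h3 := integral_polydiscMeasure_exp n (-2 * Real.pi) ξ
  simp only [← hE] at h3
  rw [hY] at h3
  rw [Real.fourier_eq']
  simp only [smul_eq_mul, ← hE]
  calc ∫ c, E c * discSumDensity n c =
      ∫ c, ∫ w, E c * discIndicator (c - ∑ i, w i) ∂polydiscMeasure n :=
        integral_congr_ae (Eventually.of_forall fun c => (integral_const_mul _ _).symm)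
    _ = ∫ w, E (∑ i, w i) * (Real.pi * besselClifford 1 (Real.pi ^ 2 * ‖ξ‖ ^ 2) : ℝ)
        ∂polydiscMeasure n := by rw [integral_integral_swap hint]; simp_rw [h1]
    _ = _ := by
      rw [integral_mul_const, h3, ← Complex.ofReal_mul, ← pow_succ]

theorem integral_radial_substitution {f : ℝ → ℝ} :
    2 * Real.pi ^ 2 * ∫ ρ in Set.Ioi (0 : ℝ), ρ * f (Real.pi ^ 2 * ρ ^ 2) =
      ∫ y in Set.Ioi (0 : ℝ), f y := by
  have h1 := integral_comp_rpow_Ioi_of_pos (g := fun x => f (Real.pi ^ 2 * x))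
    (p := 2) (by norm_num)
  have h2 := integral_comp_mul_left_Ioi' f 0 (b := Real.pi ^ 2) (by positivity)
  rw [mul_zero] at h2
  rw [← h2, ← h1, smul_eq_mul, ← integral_const_mul, ← integral_const_mul]
  refine setIntegral_congr_fun measurableSet_Ioi fun ρ _ => ?_
  norm_num
  ring

/-- Fourier inversion of a radial function in polar coordinates, followed by the substitution `y =
π² ρ²`. -/
theorem discSumDensity_eq_integral (hn : 3 ≤ n) (c : ℂ) :
    discSumDensity n c = (Real.pi ^ n * ∫ y in Set.Ioi (0 : ℝ),
      besselClifford 1 y ^ (n + 1) * besselClifford 0 (‖c‖ ^ 2 * y) : ℝ) := by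
  have hc1 := continuous_besselClifford 1
  set φ : ℝ → ℝ := fun ρ => (Real.pi * besselClifford 1 (Real.pi ^ 2 * ρ ^ 2)) ^ (n + 1) with hφ
  have hφc : Continuous φ := by fun_prop
  have hφb : ∀ ρ, |φ ρ| ≤ Real.pi ^ (n + 1) * 4 * ((1 + ρ ^ 2) ^ 2)⁻¹ := fun ρ => by
    rw [hφ]
    simp only
    rw [mul_pow, abs_mul, abs_of_nonneg (by positivity : 0 ≤ Real.pi ^ (n + 1)), abs_pow,
      mul_assoc]
    gcongr
    exact abs_besselClifford_one_pow_le_inv (by omega) ρ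
  have hF : 𝓕 (discSumDensity n) = fun ξ => (φ ‖ξ‖ : ℂ) := by
    ext ξ; exact fourier_discSumDensity n ξ
  have hFi : Integrable (𝓕 (discSumDensity n)) := by
    rw [hF]
    have h := integrable_rpow_neg_one_add_norm_sq (E := ℂ) (μ := volume) (r := 4)
      (by rw [Complex.finrank_real_complex]; norm_num)
    refine (h.const_mul (Real.pi ^ (n + 1) * 4)).mono'
      (by fun_prop : Continuous _).aestronglyMeasurable (Eventually.of_forall fun ξ => ?_)
    rw [Complex.norm_real, Real.norm_eq_abs]
    refine (hφb _).trans_eq ?_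
    rw [show (-4 / 2 : ℝ) = -((2 : ℕ) : ℝ) by norm_num, Real.rpow_neg (by positivity),
      Real.rpow_natCast]
  have hφi : IntegrableOn (fun ρ => ρ * φ ρ) (Set.Ioi 0) := by
    refine Integrable.integrableOn ?_
    refine (integrable_inv_one_add_sq.const_mul (Real.pi ^ (n + 1) * 4)).mono'
      (by fun_prop : Continuous _).aestronglyMeasurable (Eventually.of_forall fun ρ => ?_)
    rw [Real.norm_eq_abs, abs_mul]
    have h1 : |ρ| ≤ 1 + ρ ^ 2 := by rw [← sq_abs]; nlinarith [sq_nonneg (|ρ| - 1), abs_nonneg ρ]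
    calc |ρ| * |φ ρ| ≤ (1 + ρ ^ 2) * (Real.pi ^ (n + 1) * 4 * ((1 + ρ ^ 2) ^ 2)⁻¹) := by
          gcongr
          exact hφb ρ
      _ = _ := by field_simp
  have h := congrFun ((continuous_discSumDensity (by omega : 1 ≤ n)).fourierInv_fourier_eq
    (integrable_discSumDensity n) hFi) c
  rw [← h, Real.fourierInv_eq', hF]
  simp only [smul_eq_mul]
  rw [integral_radial_mul_exp hφi]
  congr 1
  have hsub := integral_radial_substitution (f := fun y =>
    (Real.pi * besselClifford 1 y) ^ (n + 1) * besselClifford 0 (‖c‖ ^ 2 * y))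
  simp only [mul_pow Real.pi, mul_assoc (Real.pi ^ (n + 1))] at hsub
  rw [integral_const_mul] at hsub
  have e : ∀ ρ : ℝ, ρ * φ ρ * besselClifford 0 ((2 * Real.pi) ^ 2 * ‖c‖ ^ 2 / 4 * ρ ^ 2) =
      ρ * (Real.pi ^ (n + 1) * (besselClifford 1 (Real.pi ^ 2 * ρ ^ 2) ^ (n + 1) *
        besselClifford 0 (‖c‖ ^ 2 * (Real.pi ^ 2 * ρ ^ 2)))) := fun ρ => by
    rw [show (2 * Real.pi) ^ 2 * ‖c‖ ^ 2 / 4 * ρ ^ 2 = ‖c‖ ^ 2 * (Real.pi ^ 2 * ρ ^ 2) by ring]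
    simp only [hφ]
    ring
  simp_rw [e]
  have hpi : Real.pi ≠ 0 := Real.pi_ne_zero
  apply mul_left_cancel₀ hpi
  linear_combination hsub

theorem sectionVol_diagVec_self_eq (hn : 4 ≤ n) (t : ℝ) :
    sectionVol (diagVec n n) (t : ℂ) = Real.pi ^ (n - 1) * diagonalIntegral n t := by
  obtain ⟨k, rfl⟩ : ∃ k, n = k + 1 := ⟨n - 1, by omega⟩
  have h1 := discSumDensity_eq k ((√((k : ℝ) + 1) * t : ℝ) : ℂ)
  rw [discSumDensity_eq_integral (by omega)] at h1
  have h2 := Complex.ofReal_injective h1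
  rw [sectionVol_diagVec_self, ← h2, diagonalIntegral, Complex.norm_real, Real.norm_eq_abs, sq_abs,
    mul_pow, Real.sq_sqrt (by positivity), Nat.add_sub_cancel]
  push_cast
  ring

end DiscSum

/-! ### Comparison of the Gaussian limit with the two-dimensional section -/

section Gap

open MeasureTheory

/-- The true quartic coefficient is `5/128`, between the `1/32` of the upper bound and the `1/20`
here. The range suffices because `t²/2 < 1/5` for `t ≤ 0.63`. -/
theorem sqrt_one_sub_ge {y : ℝ} (hy : 0 ≤ y) (hy' : y ≤ 1 / 5) :
    1 - y / 2 - y ^ 2 / 8 - y ^ 3 / 16 - y ^ 4 / 20 ≤ √(1 - y) := by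
  apply Real.le_sqrt_of_sq_le
  have h : 0 ≤ y ^ 4 * (1 / 5 - y) := by
    have : 0 ≤ 1 / 5 - y := by linarith
    positivity
  have h2 : y ^ 6 ≤ y ^ 4 * (1 / 25) := by
    have : y ^ 2 ≤ 1 / 25 := by nlinarith
    calc y ^ 6 = y ^ 4 * y ^ 2 := by ring
      _ ≤ _ := by gcongr
  have h3 : y ^ 7 ≤ y ^ 4 * (1 / 125) := by
    have : y ^ 3 ≤ (1 / 5) ^ 3 := by gcongr
    calc y ^ 7 = y ^ 4 * y ^ 3 := by ring
      _ ≤ y ^ 4 * (1 / 5) ^ 3 := by gcongr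
      _ = _ := by norm_num
  have h4 : y ^ 8 ≤ y ^ 4 * (1 / 625) := by
    have : y ^ 4 ≤ (1 / 5) ^ 4 := by gcongr
    calc y ^ 8 = y ^ 4 * y ^ 4 := by ring
      _ ≤ y ^ 4 * (1 / 5) ^ 4 := by gcongr
      _ = _ := by norm_num
  nlinarith [pow_nonneg hy 4]

theorem sqrt_one_sub_le {y : ℝ} (hy : 0 ≤ y) (hy' : y ≤ 1 / 5) :
    √(1 - y) ≤ 1 - y / 2 - y ^ 2 / 8 - y ^ 3 / 16 - y ^ 4 / 32 := by
  have h2 : y ^ 2 ≤ 1 / 25 := by nlinarith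
  have h3 : y ^ 3 ≤ 1 / 125 := by nlinarith
  have h4 : y ^ 4 ≤ 1 / 625 := by nlinarith [pow_nonneg hy 3]
  have hp := pow_nonneg hy 4
  refine Real.sqrt_le_iff.2 ⟨by nlinarith, ?_⟩
  nlinarith [pow_nonneg hy 5, pow_nonneg hy 6, pow_nonneg hy 7, pow_nonneg hy 8]

theorem integral_sqrt_one_sub_sq_ge {u : ℝ} (hu : 0 ≤ u) (hu' : u ^ 2 ≤ 1 / 5) :
    u * (1 - u ^ 2 / 6 - u ^ 4 / 40 - u ^ 6 / 112 - u ^ 8 / 180) ≤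
      ∫ s in (0 : ℝ)..u, √(1 - s ^ 2) := by
  have hc : Continuous fun s : ℝ => √(1 - s ^ 2) := by fun_prop
  have h := intervalIntegral.integral_mono_on hu
    ((by fun_prop : Continuous fun s : ℝ =>
      1 - s ^ 2 / 2 - s ^ 4 / 8 - s ^ 6 / 16 - s ^ 8 / 20).intervalIntegrable (μ := volume) 0 u)
    (hc.intervalIntegrable _ _) (fun s hs => by
      have := sqrt_one_sub_ge (sq_nonneg s)
        ((pow_le_pow_left₀ hs.1 hs.2 2).trans hu')
      simpa only [← pow_mul, Nat.reduceMul] using this)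
  refine le_trans (le_of_eq ?_) h
  have hd : ∀ s ∈ Set.uIcc 0 u, HasDerivAt
      (fun s : ℝ => s - s ^ 3 / 6 - s ^ 5 / 40 - s ^ 7 / 112 - s ^ 9 / 180)
      (1 - s ^ 2 / 2 - s ^ 4 / 8 - s ^ 6 / 16 - s ^ 8 / 20) s := fun s _ => by
    convert! ((((hasDerivAt_id s).sub ((hasDerivAt_pow 3 s).div_const 6)).sub
      ((hasDerivAt_pow 5 s).div_const 40)).sub ((hasDerivAt_pow 7 s).div_const 112)).sub
      ((hasDerivAt_pow 9 s).div_const 180) using 1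
    norm_num
    ring
  rw [intervalIntegral.integral_eq_sub_of_hasDerivAt hd
    ((by fun_prop : Continuous _).intervalIntegrable _ _)]
  ring

theorem integral_sqrt_one_sub_sq_le {u : ℝ} (hu : 0 ≤ u) (hu' : u ^ 2 ≤ 1 / 5) :
    ∫ s in (0 : ℝ)..u, √(1 - s ^ 2) ≤
      u * (1 - u ^ 2 / 6 - u ^ 4 / 40 - u ^ 6 / 112 - u ^ 8 / 288) := by
  have hc : Continuous fun s : ℝ => √(1 - s ^ 2) := by fun_prop
  have h := intervalIntegral.integral_mono_on hu (hc.intervalIntegrable (μ := volume) 0 u)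
    ((by fun_prop : Continuous fun s : ℝ =>
      1 - s ^ 2 / 2 - s ^ 4 / 8 - s ^ 6 / 16 - s ^ 8 / 32).intervalIntegrable (μ := volume) 0 u)
    (fun s hs => by
      have := sqrt_one_sub_le (sq_nonneg s)
        ((pow_le_pow_left₀ hs.1 hs.2 2).trans hu')
      simpa only [← pow_mul, Nat.reduceMul] using this)
  refine h.trans (le_of_eq ?_)
  have hd : ∀ s ∈ Set.uIcc 0 u, HasDerivAt
      (fun s : ℝ => s - s ^ 3 / 6 - s ^ 5 / 40 - s ^ 7 / 112 - s ^ 9 / 288)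
      (1 - s ^ 2 / 2 - s ^ 4 / 8 - s ^ 6 / 16 - s ^ 8 / 32) s := fun s _ => by
    convert! ((((hasDerivAt_id s).sub ((hasDerivAt_pow 3 s).div_const 6)).sub
      ((hasDerivAt_pow 5 s).div_const 40)).sub ((hasDerivAt_pow 7 s).div_const 112)).sub
      ((hasDerivAt_pow 9 s).div_const 288) using 1
    norm_num
    ring
  rw [intervalIntegral.integral_eq_sub_of_hasDerivAt hd
    ((by fun_prop : Continuous _).intervalIntegrable _ _)]
  ring

/-- The difference between the Gaussian limit and the normalized section orthogonal to `a⁽²⁾`. -/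
noncomputable def gaussianGap (t : ℝ) : ℝ :=
  2 * Real.exp (-(2 * t ^ 2)) - (2 - 8 / Real.pi * ∫ s in (0 : ℝ)..(t / √2), √(1 - s ^ 2))

theorem sqrt_two_bounds : 1.4142135 < √2 ∧ √2 < 1.4142136 := by
  constructor
  · apply Real.lt_sqrt_of_sq_lt; norm_num
  · rw [Real.sqrt_lt' (by norm_num)]; norm_num

theorem eight_div_pi_mul_bounds : 1.800632 ≤ 8 / Real.pi / √2 ∧ 8 / Real.pi / √2 ≤ 1.800633 := by
  have h1 := Real.pi_gt_d20
  have h2 := Real.pi_lt_d20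
  obtain ⟨h3, h4⟩ := sqrt_two_bounds
  have hs : √2 * √2 = 2 := Real.mul_self_sqrt (by norm_num)
  have e : 8 / Real.pi / √2 = 4 * √2 / Real.pi := by
    have := Real.pi_pos
    rw [div_div, div_eq_div_iff (by positivity) (by positivity)]
    linear_combination (-4 * Real.pi) * hs
  rw [e, le_div_iff₀ Real.pi_pos, div_le_iff₀ Real.pi_pos]
  constructor <;> linarith

theorem hasDerivAt_gaussianGap (t : ℝ) : HasDerivAt gaussianGap
    (-8 * t * Real.exp (-(2 * t ^ 2)) + 8 / Real.pi / √2 * √(1 - t ^ 2 / 2)) t := by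
  have hc : Continuous fun s : ℝ => √(1 - s ^ 2) := by fun_prop
  have h1 := (hc.integral_hasStrictDerivAt 0 (t / √2)).hasDerivAt.comp t
    ((hasDerivAt_id t).div_const √2)
  have h2 := (((hasDerivAt_pow 2 t).const_mul 2).neg).exp
  have h := (h2.const_mul 2).sub ((h1.const_mul (8 / Real.pi)).const_sub 2)
  convert! h using 1
  rw [div_pow, Real.sq_sqrt (by norm_num)]
  simp
  ring

theorem continuous_gaussianGap : Continuous gaussianGap :=
  continuous_iff_continuousAt.2 fun t => (hasDerivAt_gaussianGap t).continuousAt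

theorem gaussianGap_ge {t : ℝ} (ht : 0 ≤ t) (ht' : t ≤ 63 / 100) :
    2 * Real.exp (-(2 * t ^ 2)) - 2 +
      1.800632 * (t * (1 - t ^ 2 / 12 - t ^ 4 / 160 - t ^ 6 / 896 - t ^ 8 / 2880)) ≤
      gaussianGap t := by
  have hsq : (t / √2) ^ 2 = t ^ 2 / 2 := by rw [div_pow, Real.sq_sqrt (by norm_num)]
  have h := integral_sqrt_one_sub_sq_ge (u := t / √2) (by positivity) (by rw [hsq]; nlinarith)
  rw [show (t / √2) ^ 4 = ((t / √2) ^ 2) ^ 2 by ring, show (t / √2) ^ 6 = ((t / √2) ^ 2) ^ 3 by ring,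
    show (t / √2) ^ 8 = ((t / √2) ^ 2) ^ 4 by ring, hsq] at h
  have hq : 0 ≤ t * (1 - t ^ 2 / 12 - t ^ 4 / 160 - t ^ 6 / 896 - t ^ 8 / 2880) := by
    have h1 : t ≤ 1 := by linarith
    have := pow_le_one₀ ht h1 (n := 2)
    have := pow_le_one₀ ht h1 (n := 4)
    have := pow_le_one₀ ht h1 (n := 6)
    have := pow_le_one₀ ht h1 (n := 8)
    exact mul_nonneg ht (by linarith)
  have h2 := mul_le_mul_of_nonneg_left h (by positivity : 0 ≤ 8 / Real.pi)
  have h3 := mul_le_mul_of_nonneg_right eight_div_pi_mul_bounds.1 hq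
  have e : 8 / Real.pi * (t / √2 * (1 - t ^ 2 / 2 / 6 - (t ^ 2 / 2) ^ 2 / 40 -
      (t ^ 2 / 2) ^ 3 / 112 - (t ^ 2 / 2) ^ 4 / 180)) = 8 / Real.pi / √2 *
      (t * (1 - t ^ 2 / 12 - t ^ 4 / 160 - t ^ 6 / 896 - t ^ 8 / 2880)) := by ring
  rw [gaussianGap]
  linarith

theorem gaussianGap_le {t : ℝ} (ht : 0 ≤ t) (ht' : t ≤ 63 / 100) :
    gaussianGap t ≤ 2 * Real.exp (-(2 * t ^ 2)) - 2 +
      1.800633 * (t * (1 - t ^ 2 / 12 - t ^ 4 / 160 - t ^ 6 / 896 - t ^ 8 / 4608)) := by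
  have hsq : (t / √2) ^ 2 = t ^ 2 / 2 := by rw [div_pow, Real.sq_sqrt (by norm_num)]
  have h := integral_sqrt_one_sub_sq_le (u := t / √2) (by positivity) (by rw [hsq]; nlinarith)
  rw [show (t / √2) ^ 4 = ((t / √2) ^ 2) ^ 2 by ring, show (t / √2) ^ 6 = ((t / √2) ^ 2) ^ 3 by ring,
    show (t / √2) ^ 8 = ((t / √2) ^ 2) ^ 4 by ring, hsq] at h
  have hq : 0 ≤ t * (1 - t ^ 2 / 12 - t ^ 4 / 160 - t ^ 6 / 896 - t ^ 8 / 4608) := by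
    have h1 : t ≤ 1 := by linarith
    have := pow_le_one₀ ht h1 (n := 2)
    have := pow_le_one₀ ht h1 (n := 4)
    have := pow_le_one₀ ht h1 (n := 6)
    have := pow_le_one₀ ht h1 (n := 8)
    exact mul_nonneg ht (by linarith)
  have h2 := mul_le_mul_of_nonneg_left h (by positivity : 0 ≤ 8 / Real.pi)
  have h3 := mul_le_mul_of_nonneg_right eight_div_pi_mul_bounds.2 hq
  have e : 8 / Real.pi * (t / √2 * (1 - t ^ 2 / 2 / 6 - (t ^ 2 / 2) ^ 2 / 40 -
      (t ^ 2 / 2) ^ 3 / 112 - (t ^ 2 / 2) ^ 4 / 288)) = 8 / Real.pi / √2 *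
      (t * (1 - t ^ 2 / 12 - t ^ 4 / 160 - t ^ 6 / 896 - t ^ 8 / 4608)) := by ring
  rw [gaussianGap]
  linarith

theorem exp_neg_mem_Icc {x : ℝ} (h0 : 0 ≤ x) (h1 : x ≤ 1) :
    Real.exp (-x) ∈ Set.Icc
      (∑ m ∈ Finset.range 10, (-x) ^ m / m.factorial - 1 / 3000000 * x ^ 10)
      (∑ m ∈ Finset.range 10, (-x) ^ m / m.factorial + 1 / 3000000 * x ^ 10) := by
  have h := Real.exp_bound (x := -x) (by rw [abs_neg, abs_of_nonneg h0]; exact h1)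
    (n := 10) (by norm_num)
  rw [abs_neg, abs_of_nonneg h0, abs_le] at h
  have h2 : x ^ 10 * (((10 : ℕ).succ : ℝ) / ((10 : ℕ).factorial * (10 : ℕ))) ≤
      1 / 3000000 * x ^ 10 := by
    rw [mul_comm]
    exact mul_le_mul_of_nonneg_right (by norm_num [Nat.factorial]) (by positivity)
  constructor <;> linarith [h.1, h.2]

/-- The first three values are the nodes of the comparison in `diagonalCorrection_lt_of_half_le`;
the last two enclose the zero `t₀`. -/
theorem gaussianGap_lower_values : 0.049 ≤ gaussianGap 0.56 ∧ 0.027 ≤ gaussianGap 0.59 ∧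
    0.008 ≤ gaussianGap 0.618 ∧ 0 < gaussianGap 0.62985 ∧ gaussianGap 0.6299 < 0 := by
  refine ⟨?_, ?_, ?_, ?_, ?_⟩
  · have h := (exp_neg_mem_Icc (x := 2 * 0.56 ^ 2) (by norm_num) (by norm_num)).1
    have h2 := gaussianGap_ge (t := 0.56) (by norm_num) (by norm_num)
    norm_num [Finset.sum_range_succ, Nat.factorial] at h h2 ⊢
    linarith
  · have h := (exp_neg_mem_Icc (x := 2 * 0.59 ^ 2) (by norm_num) (by norm_num)).1
    have h2 := gaussianGap_ge (t := 0.59) (by norm_num) (by norm_num)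
    norm_num [Finset.sum_range_succ, Nat.factorial] at h h2 ⊢
    linarith
  · have h := (exp_neg_mem_Icc (x := 2 * 0.618 ^ 2) (by norm_num) (by norm_num)).1
    have h2 := gaussianGap_ge (t := 0.618) (by norm_num) (by norm_num)
    norm_num [Finset.sum_range_succ, Nat.factorial] at h h2 ⊢
    linarith
  · have h := (exp_neg_mem_Icc (x := 2 * 0.62985 ^ 2) (by norm_num) (by norm_num)).1
    have h2 := gaussianGap_ge (t := 0.62985) (by norm_num) (by norm_num)
    norm_num [Finset.sum_range_succ, Nat.factorial] at h h2 ⊢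
    linarith
  · have h := (exp_neg_mem_Icc (x := 2 * 0.6299 ^ 2) (by norm_num) (by norm_num)).2
    have h2 := gaussianGap_le (t := 0.6299) (by norm_num) (by norm_num)
    norm_num [Finset.sum_range_succ, Nat.factorial] at h h2 ⊢
    linarith

theorem exp_neg_two_mul_sq_bounds {t : ℝ} (h : 1 / 2 ≤ t) (h' : t ≤ 63 / 100) :
    0.452 ≤ Real.exp (-(2 * t ^ 2)) ∧ Real.exp (-(2 * t ^ 2)) ≤ 0.61 := by
  constructor
  · have h1 := (exp_neg_mem_Icc (x := 2 * 0.63 ^ 2) (by norm_num) (by norm_num)).1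
    refine le_trans ?_ (h1.trans (Real.exp_le_exp.2 (by nlinarith)))
    norm_num [Finset.sum_range_succ, Nat.factorial]
  · have h1 := (exp_neg_mem_Icc (x := 1 / 2) (by norm_num) (by norm_num)).2
    refine ((Real.exp_le_exp.2 (by nlinarith)).trans h1).trans ?_
    norm_num [Finset.sum_range_succ, Nat.factorial]

theorem strictAntiOn_gaussianGap : StrictAntiOn gaussianGap (Set.Icc (1 / 2) (63 / 100)) := by
  refine strictAntiOn_of_deriv_neg (convex_Icc _ _) continuous_gaussianGap.continuousOn
    fun t ht => ?_
  rw [interior_Icc] at ht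
  rw [(hasDerivAt_gaussianGap t).deriv]
  have h1 := (exp_neg_two_mul_sq_bounds ht.1.le ht.2.le).1
  have h2 := eight_div_pi_mul_bounds.2
  have h3 : √(1 - t ^ 2 / 2) ≤ 0.936 := by
    rw [Real.sqrt_le_iff]
    exact ⟨by norm_num, by nlinarith [ht.1]⟩
  have h4 : 8 / Real.pi / √2 * √(1 - t ^ 2 / 2) ≤ 1.800633 * 0.936 := by gcongr
  have h5 : 1 / 2 * 0.452 ≤ t * Real.exp (-(2 * t ^ 2)) := by
    have := ht.1
    gcongr
  linarith

end Gap

/-! ### The finite-`n` correction against the Gaussian gap. -/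

section Comparison

variable {t s : ℝ}

theorem gaussianGap_ge_polynomial (ht : 0 ≤ t) (ht' : t ≤ 63 / 100) :
    1.800632 * (t * (1 - t ^ 2 / 12 - t ^ 4 / 120)) - 4 * t ^ 2 + 4 * t ^ 4 - 8 / 3 * t ^ 6 ≤
      gaussianGap t := by
  have h := gaussianGap_ge ht ht'
  have h1 := cubic_le_exp_neg (w := 2 * t ^ 2) (by positivity)
  have h2 : t ^ 2 ≤ 2 / 5 := by nlinarith
  have h4 : t ^ 4 ≤ 4 / 25 := by
    calc t ^ 4 = (t ^ 2) ^ 2 := by ring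
      _ ≤ (2 / 5) ^ 2 := by gcongr
      _ = _ := by norm_num
  have h3 : t * (1 - t ^ 2 / 12 - t ^ 4 / 120) ≤
      t * (1 - t ^ 2 / 12 - t ^ 4 / 160 - t ^ 6 / 896 - t ^ 8 / 2880) := by
    gcongr t * ?_
    have := pow_nonneg ht 4
    nlinarith [mul_le_mul_of_nonneg_left h2 this, mul_le_mul_of_nonneg_left h4 this]
  linarith

/-- The relative size of the correction terms in the expansion of the diagonal sections. -/
noncomputable def diagonalCorrection (c s x : ℝ) : ℝ :=
  2 * Real.exp (-x) * ((x ^ 2 - 4 * x + 2) / 6 * s +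
    (-x ^ 3 + 9 * x ^ 2 - 18 * x + 6) / 18 * s ^ 2) + c * s ^ 2

theorem exp_neg_mul_laguerre_three_le {x : ℝ} (h0 : 0 ≤ x) (h1 : x ≤ 1) :
    Real.exp (-x) * (-x ^ 3 + 9 * x ^ 2 - 18 * x + 6) ≤ 6 := by
  have h := Real.add_one_le_exp x
  have h2 : -x ^ 3 + 9 * x ^ 2 - 18 * x + 6 ≤ 6 * Real.exp x := by
    nlinarith [pow_nonneg h0 3]
  calc _ ≤ Real.exp (-x) * (6 * Real.exp x) := by gcongr
    _ = 6 * (Real.exp (-x) * Real.exp x) := by ring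
    _ = 6 := by rw [← Real.exp_add]; simp

/-- Both sides are of first order: the correction is at most `2s/3 + 1.27 s²`, the gap at least
`1.76 t - 4t²`. Here `s < t`, that is `n > 1/t`, is essential. -/
theorem diagonalCorrection_lt_of_le (ht : 0 < t) (ht' : t ≤ 1 / 5) (hs : 0 < s) (hs' : s < t) :
    diagonalCorrection (837 / 2000 + 22 / 125) s (2 * t ^ 2) < gaussianGap t := by
  have hg := gaussianGap_ge_polynomial ht.le (by linarith)
  have h0 : 0 ≤ 2 * t ^ 2 := by positivity
  have h3 := exp_neg_mul_laguerre_three_le h0 (by nlinarith)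
  have hE : Real.exp (-(2 * t ^ 2)) ≤ 1 := Real.exp_le_one_iff.2 (by linarith)
  have hE0 := Real.exp_pos (-(2 * t ^ 2))
  set E := Real.exp (-(2 * t ^ 2))
  have h2 : E * ((2 * t ^ 2) ^ 2 - 4 * (2 * t ^ 2) + 2) ≤ 1 * 2 := by
    have hx : 2 * t ^ 2 ≤ 1 / 2 := by nlinarith
    gcongr <;> nlinarith
  rw [diagonalCorrection]
  have hp : 1.76 * t - 4 * t ^ 2 ≤ gaussianGap t := by
    refine le_trans ?_ hg
    have a1 : t ^ 3 ≤ 1 / 25 * t := by nlinarith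
    have a2 : t ^ 5 ≤ 1 / 25 * t ^ 3 := by nlinarith [pow_pos ht 3]
    have a3 : t ^ 6 ≤ 1 / 25 * t ^ 4 := by nlinarith [pow_pos ht 4]
    nlinarith [pow_pos ht 4]
  nlinarith

theorem diagonalCorrection_lt_of_mem_Icc (ht : 1 / 5 ≤ t) (ht' : t ≤ 1 / 2) (hs : 0 < s)
    (hs' : s ≤ 1 / 5) :
    diagonalCorrection (837 / 2000 + 22 / 125) s (2 * t ^ 2) < gaussianGap t := by
  have hg := gaussianGap_ge_polynomial (t := t) (by linarith) (by linarith)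
  have h0 : 0 ≤ 2 * t ^ 2 := by positivity
  have h3 := exp_neg_mul_laguerre_three_le h0 (by nlinarith)
  have h2 : Real.exp (-(2 * t ^ 2)) * ((2 * t ^ 2) ^ 2 - 4 * (2 * t ^ 2) + 2) ≤
      2 * (0.95 - 1.6 * (2 * t ^ 2)) := by
    have hx : 2 * t ^ 2 ≤ 1 / 2 := by nlinarith
    have hx' : 0.08 ≤ 2 * t ^ 2 := by nlinarith
    set x := 2 * t ^ 2
    have hE : Real.exp (-x) ≤ 1 - x + x ^ 2 / 2 := by
      have h := Real.quadratic_le_exp_of_nonneg h0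
      have h5 : 0 < 1 + x + x ^ 2 / 2 := by positivity
      rw [Real.exp_neg]
      refine (inv_anti₀ h5 h).trans ?_
      rw [inv_le_iff_one_le_mul₀ h5]
      nlinarith [pow_nonneg h0 4]
    calc _ ≤ (1 - x + x ^ 2 / 2) * (x ^ 2 - 4 * x + 2) := by gcongr; nlinarith
      _ ≤ _ := by nlinarith [mul_nonneg (sub_nonneg.2 hx) (sub_nonneg.2 hx'), pow_nonneg h0 2,
          mul_nonneg h0 (mul_nonneg (sub_nonneg.2 hx) (sub_nonneg.2 hx'))]
  rw [diagonalCorrection]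
  set E := Real.exp (-(2 * t ^ 2))
  have hpos : 0 ≤ 2 * (0.95 - 1.6 * (2 * t ^ 2)) := by nlinarith
  have hsq : s ^ 2 ≤ 1 / 25 := by nlinarith
  have e1 : E * ((2 * t ^ 2) ^ 2 - 4 * (2 * t ^ 2) + 2) * s ≤
      2 * (0.95 - 1.6 * (2 * t ^ 2)) * (1 / 5) := by
    refine (mul_le_mul_of_nonneg_right h2 hs.le).trans ?_
    gcongr
  have e2 : E * (-(2 * t ^ 2) ^ 3 + 9 * (2 * t ^ 2) ^ 2 - 18 * (2 * t ^ 2) + 6) * s ^ 2 ≤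
      6 * (1 / 25) := by
    refine (mul_le_mul_of_nonneg_right h3 (sq_nonneg s)).trans ?_
    gcongr
  have key : 2 / 15 * (0.95 - 1.6 * (2 * t ^ 2)) + 0.0505 <
      1.800632 * (t * (1 - t ^ 2 / 12 - t ^ 4 / 120)) - 4 * t ^ 2 + 4 * t ^ 4 -
        8 / 3 * t ^ 6 := by
    have a3 : t ^ 5 ≤ 1 / 2 * t ^ 4 := by nlinarith [pow_nonneg (by linarith : 0 ≤ t) 4]
    have a4 : t ^ 6 ≤ 1 / 4 * t ^ 4 := by
      nlinarith [pow_nonneg (by linarith : 0 ≤ t) 4, pow_nonneg (by linarith : 0 ≤ t) 5]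
    have q : 0 ≤ (t - 1 / 5) * (1 / 2 - t) :=
      mul_nonneg (by linarith) (by linarith)
    nlinarith [mul_nonneg q (sq_nonneg t), mul_nonneg q (by linarith : 0 ≤ t),
      sq_nonneg (t ^ 2 - 0.2)]
  linarith

/-- The correction is `s` times an affine function of `s` with nonnegative slope, so that function
is largest at `s = 1/5`, where the hypothesis bounds it by `q`. -/
theorem diagonalCorrection_le {q : ℝ} (hq : 0 ≤ q) (ht : 1 / 2 ≤ t) (ht' : t ≤ 63 / 100)
    (hs : 0 < s) (hs' : s ≤ 1 / 5)
    (h : 2 / 3 * Real.exp (-(2 * t ^ 2)) *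
      (1.2 - 2.6 * (2 * t ^ 2) + 0.8 * (2 * t ^ 2) ^ 2 - (2 * t ^ 2) ^ 3 / 30) + 0.098 ≤ q) :
    diagonalCorrection (837 / 2000 + 22 / 125 * (81 / 200)) s (2 * t ^ 2) ≤ q / 5 := by
  obtain ⟨hE1, hE2⟩ := exp_neg_two_mul_sq_bounds ht ht'
  have hx1 : 1 / 2 ≤ 2 * t ^ 2 := by nlinarith
  have hx2 : 2 * t ^ 2 ≤ 0.8 := by nlinarith
  rw [diagonalCorrection]
  set x := 2 * t ^ 2
  set E := Real.exp (-x)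
  have hL : -3.3 ≤ -x ^ 3 + 9 * x ^ 2 - 18 * x + 6 := by
    nlinarith [mul_nonneg (sub_nonneg.2 hx1) (sub_nonneg.2 hx2), sq_nonneg x]
  have hK : 0 ≤ E * (-x ^ 3 + 9 * x ^ 2 - 18 * x + 6) / 9 + 0.48 := by
    nlinarith
  have h1 : (E * (-x ^ 3 + 9 * x ^ 2 - 18 * x + 6) / 9 +
      (837 / 2000 + 22 / 125 * (81 / 200))) * s ≤
      (E * (-x ^ 3 + 9 * x ^ 2 - 18 * x + 6) / 9 +
      (837 / 2000 + 22 / 125 * (81 / 200))) * (1 / 5) := by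
    gcongr
    linarith
  have h2 : E * (x ^ 2 - 4 * x + 2) / 3 + (E * (-x ^ 3 + 9 * x ^ 2 - 18 * x + 6) / 9 +
      (837 / 2000 + 22 / 125 * (81 / 200))) * s ≤ q := by
    linarith
  calc _ = s * (E * (x ^ 2 - 4 * x + 2) / 3 + (E * (-x ^ 3 + 9 * x ^ 2 - 18 * x + 6) / 9 +
      (837 / 2000 + 22 / 125 * (81 / 200))) * s) := by ring
    _ ≤ s * q := by gcongr
    _ ≤ 1 / 5 * q := by gcongr
    _ = _ := by ring

theorem correction_polynomial_anti {x a : ℝ} (ha : 1 / 2 ≤ a) (hax : a ≤ x) (hx : x ≤ 0.8) :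
    1.2 - 2.6 * x + 0.8 * x ^ 2 - x ^ 3 / 30 ≤ 1.2 - 2.6 * a + 0.8 * a ^ 2 - a ^ 3 / 30 := by
  have : a ^ 3 ≤ x ^ 3 := by gcongr
  nlinarith [mul_nonneg (sub_nonneg.2 hax) (by linarith : 0 ≤ 2.6 - 0.8 * (x + a))]

/-- On each interval `[a, b]` of a subdivision, the correction polynomial is evaluated at `a` and
the gap at `b`, since both decrease. -/
theorem diagonalCorrection_lt_of_half_le (ht : 1 / 2 ≤ t) (ht' : t ≤ 63 / 100)
    (hgap : 0 < gaussianGap t) (hs : 0 < s) (hs' : s ≤ 1 / 5) :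
    diagonalCorrection (837 / 2000 + 22 / 125 * (81 / 200)) s (2 * t ^ 2) < gaussianGap t := by
  obtain ⟨hE1, hE2⟩ := exp_neg_two_mul_sq_bounds ht ht'
  obtain ⟨g1, g2, g3, -, -⟩ := gaussianGap_lower_values
  have hx2 : 2 * t ^ 2 ≤ 0.8 := by nlinarith
  have mono : ∀ b : ℝ, b ≤ 63 / 100 → t ≤ b → gaussianGap b ≤ gaussianGap t := fun b hb htb =>
    strictAntiOn_gaussianGap.antitoneOn ⟨ht, ht'⟩ ⟨ht.trans htb, hb⟩ htb
  have main : ∀ a q : ℝ, 1 / 2 ≤ a → a ≤ t → 0 ≤ q → q / 5 < gaussianGap t →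
      (∀ E : ℝ, 0.452 ≤ E → E ≤ 0.61 → 2 / 3 * E * (1.2 - 2.6 * (2 * a ^ 2) +
        0.8 * (2 * a ^ 2) ^ 2 - (2 * a ^ 2) ^ 3 / 30) + 0.098 ≤ q) →
      diagonalCorrection (837 / 2000 + 22 / 125 * (81 / 200)) s (2 * t ^ 2) < gaussianGap t := by
    intro a q ha hat hq hqg hE
    refine (diagonalCorrection_le hq ht ht' hs hs' ?_).trans_lt hqg
    refine le_trans ?_ (hE _ hE1 hE2)
    gcongr ?_ + _
    exact mul_le_mul_of_nonneg_left
      (correction_polynomial_anti (by nlinarith) (by gcongr) hx2) (by positivity)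
  rcases le_total t 0.56 with h | h
  · refine main (1 / 2) 0.14 le_rfl ht (by norm_num) ?_ fun E h1 h2 => ?_
    · linarith [mono _ (by norm_num) h]
    · norm_num at h1 h2 ⊢; linarith
  rcases le_total t 0.59 with h' | h'
  · refine main 0.56 0.07 (by norm_num) h (by norm_num) ?_ fun E h1 h2 => ?_
    · linarith [mono _ (by norm_num) h']
    · norm_num at h1 h2 ⊢; linarith
  rcases le_total t 0.618 with h'' | h''
  · refine main 0.59 0.03 (by norm_num) h' (by norm_num) ?_ fun E h1 h2 => ?_
    · linarith [mono _ (by norm_num) h'']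
    · norm_num at h1 h2 ⊢; linarith
  -- On the last interval the gap may be arbitrarily small, but the correction is nonpositive, so `q
  -- = 0` works.
  · refine main 0.618 0 (by norm_num) h'' le_rfl (by simpa using hgap) fun E h1 h2 => ?_
    norm_num at h1 h2 ⊢; linarith

theorem gaussianGap_pos_of_le_half (ht : 0 < t) (ht' : t ≤ 1 / 2) : 0 < gaussianGap t := by
  refine lt_of_lt_of_le ?_ (gaussianGap_ge_polynomial ht.le (by linarith))
  have a1 : t ^ 2 ≤ 1 / 2 * t := by nlinarith
  have a2 : t ^ 3 ≤ 1 / 2 * t ^ 2 := by nlinarith [pow_pos ht 2]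
  have a3 : t ^ 5 ≤ 1 / 2 * t ^ 4 := by nlinarith [pow_pos ht 4]
  have a4 : t ^ 6 ≤ 1 / 2 * t ^ 5 := by nlinarith [pow_pos ht 5]
  have a5 : t ^ 4 ≤ 1 / 2 * t ^ 3 := by nlinarith [pow_pos ht 3]
  have a6 := pow_pos ht 4
  nlinarith [pow_pos ht 3, mul_nonneg ht.le (sq_nonneg (t - 1 / 2)), mul_nonneg ht.le (sub_nonneg.2 ht')]

theorem lt_diagonalIntegral {n : ℕ} (hn : 5 ≤ n) (ht : 0 < t) (ht' : t ≤ 63 / 100)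
    (hgap : 0 < gaussianGap t) (hnt : 1 / t < n) :
    2 * Real.exp (-(2 * t ^ 2)) - gaussianGap t < diagonalIntegral n t := by
  have hn' : (5 : ℝ) ≤ n := by exact_mod_cast hn
  have hn0 : (0 : ℝ) < n := by linarith
  have hs : (0 : ℝ) < 1 / n := by positivity
  have hs1 : (1 : ℝ) / n ≤ 1 / 5 := one_div_le_one_div_of_le (by norm_num) hn'
  have hst : (1 : ℝ) / n < t := by
    rw [div_lt_iff₀ ht] at hnt
    rw [div_lt_iff₀ hn0]
    linarith
  have main : ∀ M : ℝ, 0 ≤ M → (∀ y, 3 ≤ y → |besselClifford 0 (n * t ^ 2 * y)| ≤ M) →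
      diagonalCorrection (837 / 2000 + 22 / 125 * M) (1 / n) (2 * t ^ 2) < gaussianGap t →
      2 * Real.exp (-(2 * t ^ 2)) - gaussianGap t < diagonalIntegral n t := by
    intro M hM0 hM h
    refine lt_of_lt_of_le ?_ (diagonalIntegral_ge hn t hM0 hM)
    rw [diagonalCorrection] at h
    calc _ < 2 * Real.exp (-(2 * t ^ 2)) - _ := sub_lt_sub_left h _
      _ = _ := by ring
  rcases le_total t (1 / 2) with h | h
  · refine main 1 zero_le_one (fun y hy => abs_besselClifford_zero_le_one (by positivity)) ?_
    rw [mul_one]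
    rcases le_total t (1 / 5) with h2 | h2
    · exact diagonalCorrection_lt_of_le ht h2 hs hst
    · exact diagonalCorrection_lt_of_mem_Icc h2 h hs hs1
  · refine main (81 / 200) (by norm_num) (fun y hy => ?_)
      (diagonalCorrection_lt_of_half_le h ht' hgap hs hs1)
    refine abs_besselClifford_zero_le_of_three_le ?_
    -- For `t ≥ 1/2` and `n ≥ 5` one has `n t² ≥ 5/4`, so the argument of `B_0` on the tail stays
    -- above `3` and `M = 81/200` is allowed.
    have : 1 ≤ n * t ^ 2 := by nlinarith
    nlinarith

end Comparison

/-! ### The theorem. -/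

theorem mainTheorem5 :
    (∀ t : ℝ,
      Tendsto (fun n : ℕ => sectionVol (diagVec n n) (t : ℂ) / Real.pi ^ (n - 1)) atTop
        (𝓝 (2 * Real.exp (-2 * t ^ 2)))) ∧
    ∃ t₀ : ℝ, 0.62985 < t₀ ∧ t₀ < 0.6299 ∧
      sectionVol (diagVec 2 2) (t₀ : ℂ) / Real.pi = 2 * Real.exp (-2 * t₀ ^ 2) ∧
      ∀ t : ℝ, 0 < t → t < t₀ →
        sectionVol (diagVec 2 2) (t : ℂ) / Real.pi < 2 * Real.exp (-2 * t ^ 2) ∧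
        ∀ n : ℕ, 5 ≤ n → 1 / t < (n : ℝ) →
          sectionVol (diagVec n 2) (t : ℂ) < sectionVol (diagVec n n) (t : ℂ) ∧
          ¬ ∀ a : EuclideanSpace ℂ (Fin n), ‖a‖ = 1 →
            sectionVol a (t : ℂ) ≤ sectionVol (diagVec n 2) (t : ℂ) := by
  have hpi := Real.pi_pos
  have hexp : ∀ t : ℝ, 2 * Real.exp (-2 * t ^ 2) = 2 * Real.exp (-(2 * t ^ 2)) := fun t => by
    rw [neg_mul]
  have hsec : ∀ (k : ℕ) (t : ℝ), 0 ≤ t → t ≤ 1 → sectionVol (diagVec (k + 2) 2) (t : ℂ) =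
      Real.pi ^ (k + 1) * (2 * Real.exp (-(2 * t ^ 2)) - gaussianGap t) := fun k t h0 h1 => by
    rw [sectionVol_diagVec_two_eq k h0 h1, gaussianGap]
    ring
  have hsec2 : ∀ t : ℝ, 0 ≤ t → t ≤ 1 → sectionVol (diagVec 2 2) (t : ℂ) / Real.pi =
      2 * Real.exp (-2 * t ^ 2) - gaussianGap t := fun t h0 h1 => by
    rw [hsec 0 t h0 h1, hexp, zero_add, pow_one, mul_div_cancel_left₀ _ hpi.ne']
  refine ⟨fun t => (tendsto_diagonalIntegral t).congr' ?_, ?_⟩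
  · filter_upwards [eventually_ge_atTop 5] with n hn
    rw [sectionVol_diagVec_self_eq (by omega), mul_div_cancel_left₀ _ (by positivity)]
  obtain ⟨-, -, -, g4, g5⟩ := gaussianGap_lower_values
  obtain ⟨t₀, ht₀, h0⟩ := intermediate_value_Icc' (by norm_num : (0.62985 : ℝ) ≤ 0.6299)
    continuous_gaussianGap.continuousOn ⟨g5.le, g4.le⟩
  have hl : 0.62985 < t₀ := lt_of_le_of_ne ht₀.1 fun h => by rw [h, h0] at g4; exact g4.false
  have hr : t₀ < 0.6299 := lt_of_le_of_ne ht₀.2 fun h => by rw [← h, h0] at g5; exact g5.false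
  refine ⟨t₀, hl, hr, ?_, fun t ht htt => ?_⟩
  · rw [hsec2 t₀ (by linarith) (by linarith), h0, sub_zero]
  have hgap : 0 < gaussianGap t := by
    rcases le_total t (1 / 2) with h | h
    · exact gaussianGap_pos_of_le_half ht h
    · rw [← h0]
      exact strictAntiOn_gaussianGap ⟨h, by linarith⟩ ⟨by linarith, by linarith⟩ htt
  refine ⟨by rw [hsec2 t ht.le (by linarith)]; linarith, fun n hn hnt => ?_⟩
  have hlt : sectionVol (diagVec n 2) (t : ℂ) < sectionVol (diagVec n n) (t : ℂ) := by
    obtain ⟨k, rfl⟩ : ∃ k, n = k + 2 := ⟨n - 2, by omega⟩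
    rw [hsec k t ht.le (by linarith), sectionVol_diagVec_self_eq (by omega)]
    have := lt_diagonalIntegral hn ht (by linarith) hgap hnt
    simp only [show k + 2 - 1 = k + 1 from rfl]
    gcongr
  exact ⟨hlt, fun h => (h _ (norm_diagVec (by omega) le_rfl)).not_gt hlt⟩
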